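/- Let $n\ge 1$ be an integer and $0<\lambda<n$. Cubes $Q\subset\mathbb R^n$ have positive side length and sides parallel to the coordinate axes, $|Q|$ is Lebesgue measure, and $g_Q=\frac1{|Q|}\int_Q g$. Let $BMO(\mathbb R^n)$ be the set of real-valued locally integrable functions $b$ on $\mathbb R^n$ with $$\|b\|_*:=\sup_Q\frac1{|Q|}\int_Q|b(y)-b_Q|\,dy<\infty .$$ For such $b$ and measurable $f$, the maximal commutator is $$C_b(f)(x):=\sup_{Q\ni x}\frac1{|Q|}\int_Q|b(x)-b(y)|\,|f(y)|\,dy\in[0,\infty],\qquad x\in\mathbb R^n .$$ With $\Phi(t)=t(1+\log^+t)$, $\log^+t=\max\{\log t,0\}$, put $$\|g\|_{L(1+\log^+L),Q}:=\inf\Big\{\alpha>0:\frac1{|Q|}\int_Q\Phi\Big(\frac{|g(y)|}{\alpha}\Big)dy\le1\Big\},\qquad \|g\|_{\mathcal M_{L(1+\log^+L),\lambda}}:=\sup_Q|Q|^{\lambda/n}\|g\|_{L(1+\log^+L),Q},$$ and let the Zygmund–Morrey space $\mathcal M_{L(1+\log^+L),\lambda}$ consist of all measurable $g$ on $\mathbb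 R^n$ for which this norm is finite. A function $f$ is radially decreasing if $f(x)=\varphi(|x|)$ for some non-increasing function $\varphi$ on $(0,\infty)$, where $|x|$ is the Euclidean norm. **Theorem.** For $b\in BMO(\mathbb R^n)$ the operator $C_b$ is bounded on $\mathcal M_{L(1+\log^+L),\lambda}$ for radially decreasing functions: there is a constant $c=c(n,\lambda)<\infty$ such that for every $b\in BMO(\mathbb R^n)$ and every radially decreasing $f\in\mathcal M_{L(1+\log^+L),\lambda}$ one has $C_b(f)\in\mathcal M_{L(1+\log^+L),\lambda}$ and $$\|C_b(f)\|_{\mathcal M_{L(1+\log^+L),\lambda}}\le c\,\|b\|_*\,\|f\|_{\mathcal M_{L(1+\log^+L),\lambda}} .$$ -/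

import Mathlib

open MeasureTheory Set
open scoped ENNReal NNReal

noncomputable section

/-- The closed cube in `ℝⁿ` with sides parallel to the coordinate axes, lowest corner `a` and
side length `ℓ`. Cubes are always used with `0 < ℓ`. -/
def cube {n : ℕ} (a : EuclideanSpace ℝ (Fin n)) (ℓ : ℝ) : Set (EuclideanSpace ℝ (Fin n)) :=
  {y | ∀ i, a i ≤ y i ∧ y i ≤ a i + ℓ}

/-- The `BMO` seminorm `‖b‖_* = sup_Q |Q|⁻¹ ∫_Q |b - b_Q|`. -/
def bmoSeminorm {n : ℕ} (b : EuclideanSpace ℝ (Fin n) → ℝ) : ℝ≥0∞ :=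
  ⨆ (a : EuclideanSpace ℝ (Fin n)) (ℓ : ℝ) (_ : 0 < ℓ),
    (volume (cube a ℓ))⁻¹ *
      ∫⁻ y in cube a ℓ, ‖b y - ⨍ z in cube a ℓ, b z ∂volume‖ₑ ∂volume

/-- `b ∈ BMO(ℝⁿ)`: `b` is locally integrable and `‖b‖_* < ∞`. -/
def MemBMO {n : ℕ} (b : EuclideanSpace ℝ (Fin n) → ℝ) : Prop :=
  LocallyIntegrable b volume ∧ bmoSeminorm b < ∞

/-- The maximal commutator `C_b(f)(x) = sup_{Q ∋ x} |Q|⁻¹ ∫_Q |b(x) - b(y)| |f(y)| dy`, with values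
in `[0, ∞]`. -/
def maximalCommutator {n : ℕ} (b f : EuclideanSpace ℝ (Fin n) → ℝ)
    (x : EuclideanSpace ℝ (Fin n)) : ℝ≥0∞ :=
  ⨆ (a : EuclideanSpace ℝ (Fin n)) (ℓ : ℝ) (_ : 0 < ℓ) (_ : x ∈ cube a ℓ),
    (volume (cube a ℓ))⁻¹ * ∫⁻ y in cube a ℓ, ‖b x - b y‖ₑ * ‖f y‖ₑ ∂volume

/-- The Young function `Φ(t) = t (1 + log⁺ t)` on `[0, ∞]`. Here `EReal.toENNReal` sends negative
values to `0`, so `(ENNReal.log t).toENNReal = max (log t) 0 = log⁺ t`, and `Φ(∞) = ∞`. -/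
def zygmundYoung (t : ℝ≥0∞) : ℝ≥0∞ :=
  t * (1 + (ENNReal.log t).toENNReal)

/-- The Luxemburg average
`‖g‖_{L(1+log⁺L),Q} = inf {α > 0 : |Q|⁻¹ ∫_Q Φ(|g| / α) ≤ 1}` with `Φ(t) = t (1 + log⁺ t)`; it is
`∞` if there is no such `α`. It is used for real-valued and for `[0, ∞]`-valued functions `g`. -/
def zygmundAverage {n : ℕ} {F : Type*} [ENorm F] (g : EuclideanSpace ℝ (Fin n) → F)
    (Q : Set (EuclideanSpace ℝ (Fin n))) : ℝ≥0∞ :=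
  sInf {α : ℝ≥0∞ | 0 < α ∧ α < ∞ ∧
    (volume Q)⁻¹ * ∫⁻ y in Q, zygmundYoung (‖g y‖ₑ / α) ∂volume ≤ 1}

/-- The Zygmund–Morrey norm `sup_Q |Q|^{lam/n} ‖g‖_{L(1+log⁺L),Q}`. -/
def zygmundMorreyNorm {n : ℕ} {F : Type*} [ENorm F] (lam : ℝ)
    (g : EuclideanSpace ℝ (Fin n) → F) : ℝ≥0∞ :=
  ⨆ (a : EuclideanSpace ℝ (Fin n)) (ℓ : ℝ) (_ : 0 < ℓ),
    volume (cube a ℓ) ^ (lam / (n : ℝ)) * zygmundAverage g (cube a ℓ)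

/-- Membership in the Zygmund–Morrey space: `g` is Lebesgue measurable with finite norm. -/
def MemZygmundMorrey {n : ℕ} {F : Type*} [ENorm F] [MeasurableSpace F] (lam : ℝ)
    (g : EuclideanSpace ℝ (Fin n) → F) : Prop :=
  AEMeasurable g volume ∧ zygmundMorreyNorm lam g < ∞

/-- `f(x) = φ(|x|)` for a non-increasing function `φ` on `(0, ∞)`; the value of `f` at the origin
is immaterial. -/
def RadiallyDecreasing {n : ℕ} (f : EuclideanSpace ℝ (Fin n) → ℝ) : Prop :=
  ∃ φ : ℝ → ℝ, AntitoneOn φ (Ioi 0) ∧ ∀ x, x ≠ 0 → f x = φ ‖x‖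

end

/-! A radially decreasing `f` of finite norm lies below a multiple of `|x|^(-λ)`: its profile is
nonnegative, so `|f| ≥ |f(x)|` almost everywhere on a cube with corner `0` and side comparable to
`|x|`, and testing the norm there gives the bound (`exists_enorm_le_mul_enorm_rpow`). It is
therefore enough to treat the single weight `|y|^(-λ)`, which has integrability to spare because `λ
< n`.

Fix a ball `B` of radius `r` and let `S(x)` be the largest deviation from `b_B` of the means of `b`
over balls centred at `x` with radii `r / 2 ^ j`. Up to constants, the commutator at almost every `x
∈ B` is at most `(S(x) + ‖b‖_*) (|x|^(-λ) + r^(-λ))` (`exists_maximalCommutator_le`). On scales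
below `r` the quantity `S` controls `b(x)` minus the local mean; on scales `2^k r` the means drift
by `O(k ‖b‖_*)`, which the factor `2^(-kλ)` from the weight absorbs.

John–Nirenberg puts `S` in every `L^p` with norm `O(‖b‖_*)`
(`exists_lintegral_dyadicMaxOsc_rpow_le`). Hölder then gives, for some `p > 1`, an `L^p` average of
`C_b(f)` over a cube of side `ℓ` of order `‖b‖_* ‖f‖ ℓ^(-λ)`
(`exists_lintegral_maximalCommutator_rpow_le`). Such averages dominate the `L(1 + log⁺ L)` ones
(`exists_zygmundAverage_le`), and the Morrey factor `ℓ^λ` cancels `ℓ^(-λ)`. -/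

open Metric Module Filter
open scoped Topology

set_option linter.unusedSectionVars false

/-! ### Means over balls and how they vary with centre and radius. -/

section BallAverages

variable {E : Type*} [NormedAddCommGroup E] [NormedSpace ℝ E] [FiniteDimensional ℝ E]
  [MeasurableSpace E] [BorelSpace E] (μ : Measure E) [μ.IsAddHaarMeasure]

/-- The mean of `b` over the closed ball with centre `x` and radius `s`. -/
noncomputable def ballAvg (b : E → ℝ) (x : E) (s : ℝ) : ℝ := ⨍ y in closedBall x s, b y ∂μ

/-- `b` has mean oscillation at most `K` over all closed balls. -/
def BallOscLE (b : E → ℝ) (K : ℝ≥0) : Prop :=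
  ∀ (c : E) (r : ℝ), 0 < r →
    ∫⁻ y in closedBall c r, ‖b y - ballAvg μ b c r‖ₑ ∂μ ≤ K * μ (closedBall c r)

/-- The largest deviation from the mean over `closedBall c r` of the means over the balls centred
at `x` with radii `r / 2 ^ j`, `j < m`. -/
noncomputable def dyadicOsc (b : E → ℝ) (m : ℕ) (c : E) (r : ℝ) (x : E) : ℝ≥0∞ :=
  ⨆ (j : ℕ) (_ : j < m), ‖ballAvg μ b x (r / 2 ^ j) - ballAvg μ b c r‖ₑ

lemma measure_closedBall_two_pow_mul (x y : E) {r : ℝ} (hr : 0 ≤ r) (i : ℕ) :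
    μ (closedBall x (2 ^ i * r)) = 2 ^ (i * finrank ℝ E) * μ (closedBall y r) := by
  rw [Measure.addHaar_closedBall μ x (by positivity), Measure.addHaar_closedBall μ y hr, mul_pow,
    ENNReal.ofReal_mul (by positivity), mul_assoc, ← pow_mul, ENNReal.ofReal_pow (by norm_num)]
  norm_num

lemma measure_closedBall_ne_zero (x : E) {r : ℝ} (hr : 0 < r) : μ (closedBall x r) ≠ 0 :=
  (measure_closedBall_pos μ x hr).ne'

lemma measure_closedBall_ne_top (x : E) (r : ℝ) : μ (closedBall x r) ≠ ∞ :=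
  measure_closedBall_lt_top.ne

variable {μ} {b : E → ℝ} {K : ℝ≥0}

lemma integrableOn_closedBall (hb : LocallyIntegrable b μ) (x : E) (r : ℝ) :
    IntegrableOn b (closedBall x r) μ :=
  hb.integrableOn_isCompact (isCompact_closedBall x r)

lemma enorm_setAverage_sub_mul_le {s : Set E} (h0 : μ s ≠ 0) (ht : μ s ≠ ∞)
    (hb : IntegrableOn b s μ) (k : ℝ) :
    ‖(⨍ y in s, b y ∂μ) - k‖ₑ * μ s ≤ ∫⁻ y in s, ‖b y - k‖ₑ ∂μ := by
  have h1 : (⨍ y in s, b y ∂μ) - k = ⨍ y in s, (b y - k) ∂μ := by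
    rw [setAverage_eq, setAverage_eq, integral_sub hb (integrableOn_const ht)]
    have : μ.real s ≠ 0 := by simp [Measure.real, ENNReal.toReal_eq_zero_iff, h0, ht]
    simp
    field_simp
  rw [h1, setAverage_eq, enorm_smul, mul_right_comm]
  have h2 : ‖(μ.real s)⁻¹‖ₑ * μ s = 1 := by
    rw [Real.enorm_eq_ofReal (by positivity), ENNReal.ofReal_inv_of_pos, Measure.real,
      ENNReal.ofReal_toReal ht, ENNReal.inv_mul_cancel h0 ht]
    exact ENNReal.toReal_pos h0 ht
  rw [h2, one_mul]
  exact enorm_integral_le_lintegral_enorm _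

lemma enorm_ballAvg_sub_mul_le (hb : LocallyIntegrable b μ) (x : E) {s : ℝ} (hs : 0 < s)
    (k : ℝ) :
    ‖ballAvg μ b x s - k‖ₑ * μ (closedBall x s) ≤ ∫⁻ y in closedBall x s, ‖b y - k‖ₑ ∂μ :=
  enorm_setAverage_sub_mul_le (measure_closedBall_ne_zero μ x hs) (measure_closedBall_ne_top μ x s)
    (integrableOn_closedBall hb x s) k

/-- The mean over the smaller ball is off by at most the oscillation integral over the larger one
divided by the smaller volume; the volume ratio is the constant. -/
lemma enorm_ballAvg_sub_ballAvg_le (hb : LocallyIntegrable b μ) (hK : BallOscLE μ b K)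
    {x c : E} {s : ℝ} (hs : 0 < s) (i : ℕ)
    (hsub : closedBall x s ⊆ closedBall c (2 ^ i * s)) :
    ‖ballAvg μ b x s - ballAvg μ b c (2 ^ i * s)‖ₑ ≤ 2 ^ (i * finrank ℝ E) * K := by
  have h1 := (enorm_ballAvg_sub_mul_le hb x hs (ballAvg μ b c (2 ^ i * s))).trans
    ((lintegral_mono_set hsub).trans (hK c (2 ^ i * s) (by positivity)))
  rw [measure_closedBall_two_pow_mul μ c x hs.le, ← mul_assoc, mul_comm (K : ℝ≥0∞)] at h1
  exact (ENNReal.mul_le_mul_iff_left (measure_closedBall_ne_zero μ x hs)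
    (measure_closedBall_ne_top μ x s)).1 h1

lemma enorm_sub_le_add (x y z : ℝ) : ‖x - z‖ₑ ≤ ‖x - y‖ₑ + ‖y - z‖ₑ := by
  simpa using enorm_add_le (x - y) (y - z)

lemma enorm_sub_le_add' (x y z : ℝ) : ‖x - z‖ₑ ≤ ‖x - y‖ₑ + ‖z - y‖ₑ := by
  rw [enorm_sub_rev z y]; exact enorm_sub_le_add x y z

/-- Means over two balls of the same radius whose centres are close. -/
lemma enorm_ballAvg_sub_ballAvg_same_radius (hb : LocallyIntegrable b μ) (hK : BallOscLE μ b K)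
    {x c : E} {s : ℝ} (hs : 0 < s) (hx : dist x c ≤ s) :
    ‖ballAvg μ b x s - ballAvg μ b c s‖ₑ ≤ 2 * 2 ^ finrank ℝ E * K := by
  have h1 := enorm_ballAvg_sub_ballAvg_le hb hK (x := x) (c := c) hs 1
    (closedBall_subset_closedBall' (by linarith))
  have h2 := enorm_ballAvg_sub_ballAvg_le hb hK (x := c) (c := c) hs 1
    (closedBall_subset_closedBall (by linarith))
  refine (enorm_sub_le_add' _ (ballAvg μ b c (2 ^ 1 * s)) _).trans ((add_le_add h1 h2).trans_eq ?_)
  rw [one_mul]; ring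

/-- Both balls lie in `closedBall c (2 * r)`, at most `2 ^ 4` times the smaller radius. This keeps
the first four dyadic scales below the stopping threshold. -/
lemma enorm_ballAvg_sub_ballAvg_lt_four (hb : LocallyIntegrable b μ) (hK : BallOscLE μ b K)
    {x c : E} {r : ℝ} (hr : 0 < r) (hx : dist x c ≤ r) {j : ℕ} (hj : j < 4) :
    ‖ballAvg μ b x (r / 2 ^ j) - ballAvg μ b c r‖ₑ ≤ 2 * 16 ^ finrank ℝ E * K := by
  have hrj : r / 2 ^ j ≤ r := div_le_self hr.le (one_le_pow₀ (by norm_num))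
  have e1 : (2 : ℝ) ^ (j + 1) * (r / 2 ^ j) = 2 ^ 1 * r := by field_simp; ring
  have h1 := enorm_ballAvg_sub_ballAvg_le hb hK (x := x) (c := c) (s := r / 2 ^ j) (by positivity)
    (j + 1) (closedBall_subset_closedBall' (by rw [e1]; linarith))
  rw [e1] at h1
  have h2 := enorm_ballAvg_sub_ballAvg_le hb hK (x := c) (c := c) hr 1
    (closedBall_subset_closedBall (by linarith))
  have h16 : ∀ i ≤ 4, (2 : ℝ≥0∞) ^ (i * finrank ℝ E) ≤ 16 ^ finrank ℝ E := by
    intro i hi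
    rw [pow_mul]
    gcongr
    calc (2 : ℝ≥0∞) ^ i ≤ 2 ^ 4 := pow_le_pow_right₀ (by norm_num) hi
      _ = 16 := by norm_num
  refine (enorm_sub_le_add' _ (ballAvg μ b c (2 ^ 1 * r)) _).trans ((add_le_add h1 h2).trans ?_)
  calc _ ≤ (16 : ℝ≥0∞) ^ finrank ℝ E * K + 16 ^ finrank ℝ E * K := by
        exact add_le_add (mul_le_mul_left (h16 _ (by omega)) _)
          (mul_le_mul_left (h16 _ (by omega)) _)
    _ = _ := by ring

-- The ball measure does not depend on the centre, so the mean is a constant times a parametric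
-- integral of an indicator on `E × E`, taken for a measurable representative of `b`.
variable (μ b) in
lemma measurable_ballAvg (hb : AEStronglyMeasurable b μ) (s : ℝ) :
    Measurable fun x => ballAvg μ b x s := by
  have e : ∀ x, ballAvg μ b x s = (μ.real (closedBall 0 s))⁻¹ *
      ∫ y, ({p : E × E | dist p.2 p.1 ≤ s}.indicator (fun p => hb.mk b p.2) (x, y)) ∂μ := by
    intro x
    rw [ballAvg, setAverage_eq, smul_eq_mul]
    congr 1
    · rw [Measure.real, Measure.real, Measure.addHaar_closedBall_center]
    · rw [setIntegral_congr_ae (g := hb.mk b) measurableSet_closedBall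
        (by filter_upwards [hb.ae_eq_mk] with y hy _ using hy),
        ← integral_indicator measurableSet_closedBall]
      rfl
  simp_rw [e]
  refine (StronglyMeasurable.integral_prod_right' (f := fun p : E × E => _) ?_).measurable.const_mul _
  refine StronglyMeasurable.indicator ?_ ?_
  · exact hb.stronglyMeasurable_mk.comp_measurable measurable_snd
  · exact (isClosed_le (by fun_prop) continuous_const).measurableSet

lemma measurable_dyadicOsc (hb : AEStronglyMeasurable b μ) (m : ℕ) (c : E) (r : ℝ) :
    Measurable (dyadicOsc μ b m c r) := by
  refine Measurable.iSup fun j => Measurable.iSup fun _ => ?_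
  exact ((measurable_ballAvg μ b hb _).sub_const _).enorm

lemma dyadicOsc_mono (c : E) (r : ℝ) (x : E) : Monotone fun m => dyadicOsc μ b m c r x := by
  intro m m' h
  exact iSup_le fun j => iSup_le fun hj => le_iSup₂_of_le j (hj.trans_le h) le_rfl

end BallAverages

/-! ### The John–Nirenberg inequality by stopping times and Vitali covering. -/

section JohnNirenberg

variable {E : Type*} [NormedAddCommGroup E] [NormedSpace ℝ E] [FiniteDimensional ℝ E]
  [MeasurableSpace E] [BorelSpace E] {μ : Measure E} [μ.IsAddHaarMeasure]
  {b : E → ℝ} {K : ℝ≥0}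

/-- Pairwise disjoint balls inside `closedBall c (2 * r)` on which the mean of `b` deviates by more
than `τ * K` have small total measure. -/
lemma mul_tsum_measure_le_of_lt_enorm_ballAvg_sub (hb : LocallyIntegrable b μ)
    (hK : BallOscLE μ b K) (hK0 : 0 < K) {c : E} {r : ℝ} (hr : 0 < r) {τ : ℝ≥0∞} {u : Set E}
    (hu : u.Countable) {s : E → ℝ} (hs : ∀ a ∈ u, 0 < s a)
    (hdisj : u.PairwiseDisjoint fun a => closedBall a (s a))
    (hsub : ∀ a ∈ u, closedBall a (s a) ⊆ closedBall c (2 * r))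
    (hlt : ∀ a ∈ u, τ * K < ‖ballAvg μ b a (s a) - ballAvg μ b c r‖ₑ) :
    τ * ∑' a : u, μ (closedBall (a : E) (s a)) ≤
      2 ^ finrank ℝ E * (1 + 2 ^ finrank ℝ E) * μ (closedBall c r) := by
  have : Countable u := hu.to_subtype
  have hK' : (K : ℝ≥0∞) ≠ 0 := by simpa using hK0.ne'
  have e2 : (2 : ℝ) ^ 1 * r = 2 * r := by ring
  have h1 : (τ * K) * ∑' a : u, μ (closedBall (a : E) (s a)) ≤
      ∫⁻ y in closedBall c (2 * r), ‖b y - ballAvg μ b c r‖ₑ ∂μ := by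
    rw [← ENNReal.tsum_mul_left]
    calc ∑' a : u, τ * K * μ (closedBall (a : E) (s a))
        ≤ ∑' a : u, ∫⁻ y in closedBall (a : E) (s a), ‖b y - ballAvg μ b c r‖ₑ ∂μ := by
          refine ENNReal.tsum_le_tsum fun a => ?_
          exact (mul_le_mul_left (hlt a a.2).le _).trans
            (enorm_ballAvg_sub_mul_le hb _ (hs a a.2) _)
      _ = ∫⁻ y in ⋃ a : u, closedBall (a : E) (s a), ‖b y - ballAvg μ b c r‖ₑ ∂μ := by
          rw [lintegral_iUnion (fun _ => measurableSet_closedBall)]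
          exact fun a a' h => hdisj a.2 a'.2 (by simpa [Subtype.ext_iff] using h)
      _ ≤ _ := lintegral_mono_set (iUnion_subset fun a => hsub a a.2)
  have h2 : ∫⁻ y in closedBall c (2 * r), ‖b y - ballAvg μ b c r‖ₑ ∂μ ≤
      K * (2 ^ finrank ℝ E * (1 + 2 ^ finrank ℝ E) * μ (closedBall c r)) := by
    have h3 := enorm_ballAvg_sub_ballAvg_le hb hK (x := c) (c := c) hr 1
      (closedBall_subset_closedBall (by linarith))
    rw [e2, one_mul] at h3
    have h4 := hK c (2 * r) (by positivity)
    have h5 : μ (closedBall c (2 * r)) = 2 ^ finrank ℝ E * μ (closedBall c r) := by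
      rw [← e2, measure_closedBall_two_pow_mul μ c c hr.le, one_mul]
    calc _ ≤ ∫⁻ y in closedBall c (2 * r), (‖b y - ballAvg μ b c (2 * r)‖ₑ +
          2 ^ finrank ℝ E * K) ∂μ := by
          refine lintegral_mono fun y => ?_
          exact (enorm_sub_le_add' _ (ballAvg μ b c (2 * r)) _).trans (by gcongr)
      _ ≤ K * μ (closedBall c (2 * r)) + 2 ^ finrank ℝ E * K * μ (closedBall c (2 * r)) := by
          rw [lintegral_add_right _ measurable_const, setLIntegral_const]
          gcongr
      _ = _ := by rw [h5]; ring
  have h6 := h1.trans h2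
  rw [mul_comm τ, mul_assoc] at h6
  exact (ENNReal.mul_le_mul_iff_right hK' ENNReal.coe_ne_top).1 h6

/-- Stopping-time covering: off a set where the deviation is at most `τ * K`, it is controlled by
the deviation relative to balls of small total measure. -/
lemma exists_stopping_balls (hb : LocallyIntegrable b μ) (hK : BallOscLE μ b K) (hK0 : 0 < K)
    {τ : ℝ≥0∞} (hτ : 2 * 16 ^ finrank ℝ E ≤ τ) (m : ℕ) (c : E) {r : ℝ} (hr : 0 < r) :
    ∃ (u : Set E) (ρ : E → ℝ), u.Countable ∧ (∀ a ∈ u, 0 < ρ a) ∧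
      τ * ∑' a : u, μ (closedBall (a : E) (ρ a)) ≤
        4 ^ finrank ℝ E * (2 ^ finrank ℝ E * (1 + 2 ^ finrank ℝ E)) * μ (closedBall c r) ∧
      ∀ x ∈ closedBall c r, dyadicOsc μ b (m + 1) c r x ≤ τ * K ∨
        ∃ a ∈ u, x ∈ closedBall a (ρ a) ∧
          dyadicOsc μ b (m + 1) c r x ≤ dyadicOsc μ b m a (ρ a) x + 2 * (τ * K) := by
  classical
  set G : Set E := {x | x ∈ closedBall c r ∧ τ * K < dyadicOsc μ b (m + 1) c r x} with hG
  have hex : ∀ x ∈ G, ∃ j, j < m + 1 ∧ τ * K < ‖ballAvg μ b x (r / 2 ^ j) - ballAvg μ b c r‖ₑ := by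
    rintro x ⟨-, hx⟩
    simpa [dyadicOsc, lt_iSup_iff] using hx
  have hex' : ∀ x, ∃ j : ℕ, x ∈ G → (4 ≤ j ∧ j < m + 1 ∧
      τ * K < ‖ballAvg μ b x (r / 2 ^ j) - ballAvg μ b c r‖ₑ ∧
      ∀ i < j, ‖ballAvg μ b x (r / 2 ^ i) - ballAvg μ b c r‖ₑ ≤ τ * K) := by
    intro x
    by_cases hx : x ∈ G
    · refine ⟨Nat.find (hex x hx), fun _ => ⟨?_, (Nat.find_spec (hex x hx)).1,
        (Nat.find_spec (hex x hx)).2, ?_⟩⟩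
      -- The threshold `τ ≥ 2 * 16 ^ d` rules out stopping at the first four scales.
      · by_contra! hlt
        refine ((Nat.find_spec (hex x hx)).2.trans_le
          (enorm_ballAvg_sub_ballAvg_lt_four hb hK hr hx.1 hlt)).not_ge ?_
        gcongr
      · intro i hi
        by_contra! hlt
        exact Nat.find_min (hex x hx) hi ⟨hi.trans (Nat.find_spec (hex x hx)).1, hlt⟩
    · exact ⟨0, fun h => (hx h).elim⟩
  choose j hj using hex'
  have hspos : ∀ a, 0 < r / 2 ^ j a := fun a => by positivity
  have hsle : ∀ a, r / 2 ^ j a ≤ r := fun a => div_le_self hr.le (one_le_pow₀ (by norm_num))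
  -- Vitali needs an enlargement factor above `3`; the choice `4` keeps the enlarged radii dyadic,
  -- moving the index from `j a` to `j a - 2`.
  obtain ⟨u, huG, hdisj, hcov⟩ := Vitali.exists_disjoint_subfamily_covering_enlargement_closedBall
    G id (fun a => r / 2 ^ j a) r (fun a _ => hsle a) 4 (by norm_num)
  simp only [id] at hdisj hcov
  have hucount : u.Countable := by
    refine hdisj.countable_of_nonempty_interior fun a _ => ⟨a, ?_⟩
    exact ball_subset_interior_closedBall (mem_ball_self (hspos a))
  have hρ : ∀ a ∈ u, 4 * (r / 2 ^ j a) = r / 2 ^ (j a - 2) := by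
    intro a ha
    obtain ⟨k, hk⟩ : ∃ k, j a = k + 2 := ⟨j a - 2, by have := (hj a (huG ha)).1; omega⟩
    rw [hk, Nat.add_sub_cancel, pow_add]
    field_simp
    norm_num
  refine ⟨u, fun a => 4 * (r / 2 ^ j a), hucount, fun a _ => by positivity, ?_, ?_⟩
  · have h1 := mul_tsum_measure_le_of_lt_enorm_ballAvg_sub hb hK hK0 hr (τ := τ) hucount
      (s := fun a => r / 2 ^ j a) (fun a _ => hspos a) hdisj
      (fun a ha => closedBall_subset_closedBall' (by
        have := (huG ha).1; rw [mem_closedBall] at this; linarith [hsle a]))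
      (fun a ha => (hj a (huG ha)).2.2.1)
    have h2 : ∀ a : E, μ (closedBall a (4 * (r / 2 ^ j a))) =
        4 ^ finrank ℝ E * μ (closedBall a (r / 2 ^ j a)) := by
      intro a
      have := measure_closedBall_two_pow_mul μ a a (hspos a).le 2
      rw [pow_mul] at this
      norm_num at this ⊢
      exact this
    simp_rw [h2]
    rw [ENNReal.tsum_mul_left, mul_left_comm, mul_assoc]
    gcongr
  · intro x hx
    by_cases hxG : τ * K < dyadicOsc μ b (m + 1) c r x
    swap
    · exact Or.inl (not_lt.1 hxG)
    right
    obtain ⟨a, hau, hax⟩ := hcov x ⟨hx, hxG⟩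
    have hxa : x ∈ closedBall a (4 * (r / 2 ^ j a)) := hax (mem_closedBall_self (hspos x).le)
    refine ⟨a, hau, hxa, iSup_le fun i => iSup_le fun hi => ?_⟩
    obtain ⟨h4, hjm, -, hmin⟩ := hj a (huG hau)
    -- Scales at or below the enlarged stopping ball: the ball about `x` is one of its dyadic
    -- scales, with index below `m` since `j a ≥ 4`. By minimality of `j a`, the mean over the
    -- enlarged ball is still within `τ * K` of that over `closedBall c r`.
    by_cases hij : j a - 2 ≤ i
    · have e1 : r / 2 ^ i = (4 * (r / 2 ^ j a)) / 2 ^ (i - (j a - 2)) := by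
        rw [hρ a hau, div_div, ← pow_add]
        congr 2; omega
      have h5 : ‖ballAvg μ b x (r / 2 ^ i) - ballAvg μ b a (4 * (r / 2 ^ j a))‖ₑ ≤
          dyadicOsc μ b m a (4 * (r / 2 ^ j a)) x := by
        rw [e1]
        exact le_iSup₂_of_le (i - (j a - 2)) (by omega) le_rfl
      refine (enorm_sub_le_add _ (ballAvg μ b a (4 * (r / 2 ^ j a))) _).trans (add_le_add h5 ?_)
      rw [hρ a hau]
      exact (hmin _ (by omega)).trans (le_mul_of_one_le_left' (by norm_num))
    -- Larger scales: `x` is within `r / 2 ^ i` of `a`, so the mean can be recentred at `a`, where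
    -- scale `i` precedes the stopping index.
    · refine le_add_left ?_
      have hd : dist x a ≤ r / 2 ^ i := by
        refine (mem_closedBall.1 hxa).trans ?_
        rw [hρ a hau]
        gcongr
        · norm_num
        · omega
      refine (enorm_sub_le_add _ (ballAvg μ b a (r / 2 ^ i)) _).trans ?_
      rw [two_mul]
      refine add_le_add ((enorm_ballAvg_sub_ballAvg_same_radius hb hK (by positivity) hd).trans ?_)
        (hmin i (by omega))
      gcongr
      refine le_trans ?_ hτ
      gcongr
      norm_num

/-- John–Nirenberg: `L^p` bound for the dyadic deviations up to a finite depth. -/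
lemma lintegral_dyadicOsc_rpow_le (hb : LocallyIntegrable b μ) (hK : BallOscLE μ b K) (hK0 : 0 < K)
    {p : ℝ} (hp : 1 ≤ p) {τ : ℝ≥0∞} (hτt : τ ≠ ∞) (hτ : 2 * 16 ^ finrank ℝ E ≤ τ)
    (hτ' : 2 * (2 ^ (p - 1) * (4 ^ finrank ℝ E * (2 ^ finrank ℝ E * (1 + 2 ^ finrank ℝ E)))) ≤ τ)
    (m : ℕ) (c : E) {r : ℝ} (hr : 0 < r) :
    ∫⁻ x in closedBall c r, dyadicOsc μ b m c r x ^ p ∂μ ≤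
      (4 * (τ * K)) ^ p * μ (closedBall c r) := by
  have hp0 : 0 < p := by linarith
  have hτ0 : τ ≠ 0 := by
    rintro rfl
    simp at hτ
  -- Truncating the depth makes the base case zero, so the estimate closes without knowing
  -- beforehand that the integral is finite. The bound is uniform in `m`.
  induction m generalizing c r with
  | zero => simp [dyadicOsc, hp0]
  | succ m ih =>
    obtain ⟨u, ρ, hu, hρ, hsum, hx⟩ := exists_stopping_balls hb hK hK0 hτ m c hr
    have : Countable u := hu.to_subtype
    set t : ℝ≥0∞ := τ * K with ht
    have hcover : closedBall c r ⊆ {x ∈ closedBall c r | dyadicOsc μ b (m + 1) c r x ≤ t} ∪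
        ⋃ a : u, {x ∈ closedBall (a : E) (ρ a) |
          dyadicOsc μ b (m + 1) c r x ≤ dyadicOsc μ b m a (ρ a) x + 2 * t} := by
      intro x hxc
      rcases hx x hxc with h | ⟨a, ha, h1, h2⟩
      · exact Or.inl ⟨hxc, h⟩
      · exact Or.inr (mem_iUnion.2 ⟨⟨a, ha⟩, h1, h2⟩)
    have hfst : ∫⁻ x in {x ∈ closedBall c r | dyadicOsc μ b (m + 1) c r x ≤ t},
        dyadicOsc μ b (m + 1) c r x ^ p ∂μ ≤ t ^ p * μ (closedBall c r) := by
      refine (setLIntegral_mono measurable_const (g := fun _ => t ^ p) fun x hx =>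
        ENNReal.rpow_le_rpow hx.2 hp0.le).trans ?_
      rw [setLIntegral_const]
      gcongr
      exact sep_subset _ _
    have hsnd : ∀ a : u, ∫⁻ x in {x ∈ closedBall (a : E) (ρ a) |
          dyadicOsc μ b (m + 1) c r x ≤ dyadicOsc μ b m a (ρ a) x + 2 * t},
        dyadicOsc μ b (m + 1) c r x ^ p ∂μ ≤
          2 ^ (p - 1) * ((4 * t) ^ p + (2 * t) ^ p) * μ (closedBall (a : E) (ρ a)) := by
      intro a
      have hmeas := measurable_dyadicOsc hb.aestronglyMeasurable m (a : E) (ρ a)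
      calc _ ≤ ∫⁻ x in {x ∈ closedBall (a : E) (ρ a) |
              dyadicOsc μ b (m + 1) c r x ≤ dyadicOsc μ b m a (ρ a) x + 2 * t},
              2 ^ (p - 1) * (dyadicOsc μ b m a (ρ a) x ^ p + (2 * t) ^ p) ∂μ := by
            refine setLIntegral_mono (((hmeas.pow_const p).add_const _).const_mul _) fun x hx => ?_
            exact (ENNReal.rpow_le_rpow hx.2 hp0.le).trans
              (ENNReal.rpow_add_le_mul_rpow_add_rpow _ _ hp)
        _ ≤ ∫⁻ x in closedBall (a : E) (ρ a),
              2 ^ (p - 1) * (dyadicOsc μ b m a (ρ a) x ^ p + (2 * t) ^ p) ∂μ :=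
            lintegral_mono_set (sep_subset _ _)
        _ = 2 ^ (p - 1) * (∫⁻ x in closedBall (a : E) (ρ a), dyadicOsc μ b m a (ρ a) x ^ p ∂μ +
              (2 * t) ^ p * μ (closedBall (a : E) (ρ a))) := by
            rw [lintegral_const_mul _ ((hmeas.pow_const p).add_const _),
              lintegral_add_right _ measurable_const, setLIntegral_const]
        _ ≤ 2 ^ (p - 1) * ((4 * t) ^ p * μ (closedBall (a : E) (ρ a)) +
              (2 * t) ^ p * μ (closedBall (a : E) (ρ a))) := by
            gcongr
            exact ih a (hρ a a.2)
        _ = _ := by ring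
    set A : ℝ≥0∞ := 4 ^ finrank ℝ E * (2 ^ finrank ℝ E * (1 + 2 ^ finrank ℝ E)) with hA
    -- The second lower bound on `τ` is what makes the stopping balls carry at most half of the
    -- mass, even after the loss `2 ^ (p - 1)` from convexity.
    have hθ : 2 * (2 ^ (p - 1) * ∑' a : u, μ (closedBall (a : E) (ρ a))) ≤ μ (closedBall c r) := by
      refine (ENNReal.mul_le_mul_iff_right hτ0 hτt).1 ?_
      calc τ * (2 * (2 ^ (p - 1) * ∑' a : u, μ (closedBall (a : E) (ρ a))))
          = 2 * 2 ^ (p - 1) * (τ * ∑' a : u, μ (closedBall (a : E) (ρ a))) := by ring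
        _ ≤ 2 * 2 ^ (p - 1) * (A * μ (closedBall c r)) := by gcongr
        _ = 2 * (2 ^ (p - 1) * A) * μ (closedBall c r) := by ring
        _ ≤ _ := by gcongr
    have hall : ∫⁻ x in closedBall c r, dyadicOsc μ b (m + 1) c r x ^ p ∂μ ≤
        t ^ p * μ (closedBall c r) + ((4 * t) ^ p + (2 * t) ^ p) *
          (2 ^ (p - 1) * ∑' a : u, μ (closedBall (a : E) (ρ a))) := by
      refine (lintegral_mono_set hcover).trans ((lintegral_union_le _ _ _).trans
        (add_le_add hfst ((lintegral_iUnion_le _ _).trans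
          ((ENNReal.tsum_le_tsum hsnd).trans_eq ?_))))
      rw [ENNReal.tsum_mul_left]
      ring
    -- The same constant `4` survives the induction because `2 + 2 ^ p ≤ 4 ^ p`.
    have h4 : 2 * t ^ p + (2 * t) ^ p ≤ (4 * t) ^ p := by
      rw [ENNReal.mul_rpow_of_nonneg 2 t hp0.le, ENNReal.mul_rpow_of_nonneg 4 t hp0.le, ← add_mul]
      gcongr
      have h22 : (2 : ℝ≥0∞) ≤ 2 ^ p := by
        simpa using ENNReal.rpow_le_rpow_of_exponent_le (x := 2) (by norm_num) hp
      calc (2 : ℝ≥0∞) + 2 ^ p ≤ 2 ^ p + 2 ^ p := by gcongr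
        _ = 2 * 2 ^ p := by ring
        _ ≤ 2 ^ p * 2 ^ p := by gcongr
        _ = 4 ^ p := by rw [← ENNReal.mul_rpow_of_nonneg _ _ hp0.le]; norm_num
    refine (ENNReal.mul_le_mul_iff_right two_ne_zero ENNReal.ofNat_ne_top).1 ?_
    calc 2 * ∫⁻ x in closedBall c r, dyadicOsc μ b (m + 1) c r x ^ p ∂μ
        ≤ 2 * (t ^ p * μ (closedBall c r) + ((4 * t) ^ p + (2 * t) ^ p) *
          (2 ^ (p - 1) * ∑' a : u, μ (closedBall (a : E) (ρ a)))) := by gcongr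
      _ = 2 * t ^ p * μ (closedBall c r) + ((4 * t) ^ p + (2 * t) ^ p) *
          (2 * (2 ^ (p - 1) * ∑' a : u, μ (closedBall (a : E) (ρ a)))) := by ring
      _ ≤ 2 * t ^ p * μ (closedBall c r) + ((4 * t) ^ p + (2 * t) ^ p) * μ (closedBall c r) := by
          gcongr
      _ = ((2 * t ^ p + (2 * t) ^ p) + (4 * t) ^ p) * μ (closedBall c r) := by ring
      _ ≤ ((4 * t) ^ p + (4 * t) ^ p) * μ (closedBall c r) := by gcongr
      _ = _ := by ring

/-- The largest deviation from the mean over `closedBall c r` of the means over the balls centred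
at `x` with radii `r / 2 ^ j`. -/
noncomputable def dyadicMaxOsc (μ : Measure E) (b : E → ℝ) (c : E) (r : ℝ) (x : E) : ℝ≥0∞ :=
  ⨆ j : ℕ, ‖ballAvg μ b x (r / 2 ^ j) - ballAvg μ b c r‖ₑ

lemma measurable_dyadicMaxOsc (hb : AEStronglyMeasurable b μ) (c : E) (r : ℝ) :
    Measurable (dyadicMaxOsc μ b c r) :=
  Measurable.iSup fun _ => ((measurable_ballAvg μ b hb _).sub_const _).enorm

lemma dyadicMaxOsc_eq_iSup (c : E) (r : ℝ) (x : E) :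
    dyadicMaxOsc μ b c r x = ⨆ m, dyadicOsc μ b m c r x := by
  refine le_antisymm (iSup_le fun j => ?_) (iSup_le fun m => iSup_le fun j => iSup_le fun _ => ?_)
  · exact le_iSup_of_le (j + 1) (le_iSup₂_of_le j (Nat.lt_succ_self j) le_rfl)
  · exact le_iSup_of_le j le_rfl

variable (μ) in
/-- John–Nirenberg: `L^p` bound for the dyadic maximal deviation. -/
theorem exists_lintegral_dyadicMaxOsc_rpow_le {p : ℝ} (hp : 1 ≤ p) :
    ∃ D : ℝ≥0, ∀ (b : E → ℝ) (K : ℝ≥0), LocallyIntegrable b μ → BallOscLE μ b K → 0 < K →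
      ∀ (c : E) (r : ℝ), 0 < r →
        ∫⁻ x in closedBall c r, dyadicMaxOsc μ b c r x ^ p ∂μ ≤
          (D * K) ^ p * μ (closedBall c r) := by
  set τ : ℝ≥0 := 2 * 16 ^ finrank ℝ E +
    2 * (2 ^ (p - 1) * (4 ^ finrank ℝ E * (2 ^ finrank ℝ E * (1 + 2 ^ finrank ℝ E)))) with hτ
  have hp0 : 0 < p := by linarith
  have hcoe : (τ : ℝ≥0∞) = 2 * 16 ^ finrank ℝ E +
      2 * (2 ^ (p - 1) * (4 ^ finrank ℝ E * (2 ^ finrank ℝ E * (1 + 2 ^ finrank ℝ E)))) := by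
    rw [hτ]
    push_cast [ENNReal.coe_rpow_of_nonneg _ (sub_nonneg.2 hp)]
    rfl
  refine ⟨4 * τ, fun b K hb hK hK0 c r hr => ?_⟩
  have hle := fun m => lintegral_dyadicOsc_rpow_le hb hK hK0 hp (τ := τ) ENNReal.coe_ne_top
    (hcoe ▸ le_self_add) (hcoe ▸ le_add_self) m c hr
  have hmono : ∀ x, dyadicMaxOsc μ b c r x ^ p = ⨆ m, dyadicOsc μ b m c r x ^ p := by
    intro x
    rw [dyadicMaxOsc_eq_iSup]
    exact (ENNReal.orderIsoRpow p hp0).map_iSup _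
  simp_rw [hmono]
  rw [lintegral_iSup (fun m => (measurable_dyadicOsc hb.aestronglyMeasurable m c r).pow_const p)
    (fun m m' h x => ENNReal.rpow_le_rpow (dyadicOsc_mono c r x h) hp0.le)]
  refine iSup_le fun m => (hle m).trans_eq ?_
  push_cast
  rw [mul_assoc (4 : ℝ≥0∞)]

/-- At almost every point the deviation of `b` itself is at most the maximal dyadic deviation. -/
lemma ae_enorm_sub_ballAvg_le_dyadicMaxOsc (hb : LocallyIntegrable b μ) :
    ∀ᵐ x ∂μ, ∀ (c : E) (r : ℝ), 0 < r → ‖b x - ballAvg μ b c r‖ₑ ≤ dyadicMaxOsc μ b c r x := by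
  filter_upwards [IsUnifLocDoublingMeasure.ae_tendsto_average μ hb 1] with x hx c r hr
  have h1 : Tendsto (fun j : ℕ => r / 2 ^ j) atTop (𝓝[>] 0) := by
    refine tendsto_nhdsWithin_iff.2 ⟨?_, Eventually.of_forall fun j => ?_⟩
    · simpa [div_eq_mul_inv] using (tendsto_pow_atTop_nhds_zero_of_lt_one (r := (2 : ℝ)⁻¹)
        (by norm_num) (by norm_num)).const_mul r
    · exact mem_Ioi.2 (by positivity)
  have h2 := hx (fun _ : ℕ => x) (fun j => r / 2 ^ j) h1
    (Eventually.of_forall fun j => mem_closedBall_self (by positivity))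
  exact le_of_tendsto ((h2.sub_const (ballAvg μ b c r)).enorm)
    (Eventually.of_forall fun j => le_iSup (fun j : ℕ => ‖ballAvg μ b x (r / 2 ^ j) -
      ballAvg μ b c r‖ₑ) j)

end JohnNirenberg

/-! ### Averages of the weight `‖y‖ ^ (-α)` over balls. -/

section PowerWeights

variable {E : Type*} [NormedAddCommGroup E] [NormedSpace ℝ E] [FiniteDimensional ℝ E]
  [MeasurableSpace E] [BorelSpace E] (μ : Measure E) [μ.IsAddHaarMeasure]

lemma lintegral_closedBall_one_enorm_rpow_lt_top {α : ℝ} (h0 : 0 < α) (hα : α < finrank ℝ E) :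
    ∫⁻ y in closedBall (0 : E) 1, ‖y‖ₑ ^ (-α) ∂μ < ∞ := by
  have hd : 1 ≤ finrank ℝ E := by
    by_contra! h
    have : finrank ℝ E = 0 := by omega
    rw [this] at hα
    norm_num at hα
    linarith
  have : Nontrivial E := Module.nontrivial_of_finrank_pos (R := ℝ) (by omega)
  have h1 : IntegrableOn (fun y : E => ‖y‖ ^ (-α)) (ball 0 2) μ :=
    integrableOn_ball_of_norm_le_rpow hd hα (C := 1)
      (Eventually.of_forall fun x => by
        rw [Real.norm_of_nonneg (by positivity), one_mul])
      (measurable_norm.pow_const _).aestronglyMeasurable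
  have h2 := (h1.mono_set (closedBall_subset_ball (by norm_num : (1 : ℝ) < 2))).2
  refine lt_of_eq_of_lt (lintegral_congr_ae ?_) h2
  have h3 : ∀ᵐ y ∂μ, y ≠ 0 := by simp [ae_iff]
  filter_upwards [ae_restrict_of_ae h3] with y hy
  rw [Real.enorm_eq_ofReal (by positivity), ← ofReal_norm,
    ENNReal.ofReal_rpow_of_pos (norm_pos_iff.2 hy)]

lemma lintegral_closedBall_zero_enorm_rpow (α : ℝ) {R : ℝ} (hR : 0 < R) :
    ∫⁻ y in closedBall (0 : E) R, ‖y‖ₑ ^ (-α) ∂μ =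
      ENNReal.ofReal (R ^ finrank ℝ E) * (ENNReal.ofReal R ^ (-α) *
        ∫⁻ y in closedBall (0 : E) 1, ‖y‖ₑ ^ (-α) ∂μ) := by
  have hm : Measurable fun y : E => ‖y‖ₑ ^ (-α) := measurable_enorm.pow_const _
  have h1 := Measure.map_addHaar_smul μ hR.ne'
  have h2 : ∫⁻ y, (closedBall (0 : E) R).indicator (fun y => ‖y‖ₑ ^ (-α)) y ∂(μ.map (R • ·)) =
      ENNReal.ofReal R ^ (-α) * ∫⁻ y in closedBall (0 : E) 1, ‖y‖ₑ ^ (-α) ∂μ := by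
    rw [lintegral_map (hm.indicator measurableSet_closedBall) (by fun_prop),
      ← lintegral_const_mul _ hm, ← lintegral_indicator measurableSet_closedBall]
    refine lintegral_congr fun y => ?_
    have hmem : R • y ∈ closedBall (0 : E) R ↔ y ∈ closedBall (0 : E) 1 := by
      rw [mem_closedBall_zero_iff, mem_closedBall_zero_iff, norm_smul, Real.norm_of_nonneg hR.le]
      exact mul_le_iff_le_one_right hR
    by_cases hy : y ∈ closedBall (0 : E) 1
    · rw [indicator_of_mem hy, indicator_of_mem (hmem.2 hy), enorm_smul,
        Real.enorm_eq_ofReal hR.le, ENNReal.mul_rpow_of_ne_top ENNReal.ofReal_ne_top enorm_ne_top]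
    · rw [indicator_of_notMem hy, indicator_of_notMem (fun h => hy (hmem.1 h))]
  rw [h1, lintegral_smul_measure, lintegral_indicator measurableSet_closedBall, smul_eq_mul] at h2
  rw [← h2, ← mul_assoc, ← ENNReal.ofReal_mul (by positivity), abs_of_pos (by positivity),
    mul_inv_cancel₀ (by positivity), ENNReal.ofReal_one, one_mul]

/-- The power weight `‖y‖ ^ (-α)` with `0 < α < dim E` has averages over balls controlled by the
radius and by its value at the centre. -/
lemma exists_lintegral_closedBall_enorm_rpow_le {α : ℝ} (h0 : 0 < α) (hα : α < finrank ℝ E) :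
    ∃ C : ℝ≥0, ∀ (x : E) (ρ : ℝ), 0 < ρ →
      ∫⁻ y in closedBall x ρ, ‖y‖ₑ ^ (-α) ∂μ ≤
        C * max (ENNReal.ofReal ρ) ‖x‖ₑ ^ (-α) * μ (closedBall x ρ) := by
  have hω0 : μ (ball (0 : E) 1) ≠ 0 := (measure_ball_pos μ _ one_pos).ne'
  have hωt : μ (ball (0 : E) 1) ≠ ∞ := measure_ball_lt_top.ne
  set I := ∫⁻ y in closedBall (0 : E) 1, ‖y‖ₑ ^ (-α) ∂μ with hI
  have hIt : I ≠ ∞ := (lintegral_closedBall_one_enorm_rpow_lt_top μ h0 hα).ne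
  set C₁ : ℝ≥0∞ := 3 ^ finrank ℝ E * (2 ^ α * (I / μ (ball (0 : E) 1))) + 2 ^ α with hC
  have hCt : C₁ ≠ ∞ := by
    refine ENNReal.add_ne_top.2 ⟨ENNReal.mul_ne_top (by simp) (ENNReal.mul_ne_top ?_ ?_), ?_⟩
    · exact ENNReal.rpow_ne_top_of_nonneg h0.le (by simp)
    · exact ENNReal.div_ne_top hIt hω0
    · exact ENNReal.rpow_ne_top_of_nonneg h0.le (by simp)
  have hhalf : ∀ a c : ℝ≥0∞, a ≤ 2 * c → c ^ (-α) ≤ 2 ^ α * a ^ (-α) := by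
    intro a c h
    calc c ^ (-α) = 2 ^ α * (2 * c) ^ (-α) := by
          rw [ENNReal.rpow_neg, ENNReal.rpow_neg, ENNReal.mul_rpow_of_nonneg _ _ h0.le,
            ENNReal.mul_inv (by simp) (by simp), ← mul_assoc, ENNReal.mul_inv_cancel (by simp)
            (ENNReal.rpow_ne_top_of_nonneg h0.le (by simp)), one_mul]
      _ ≤ _ := by
          gcongr 2 ^ α * ?_
          rw [ENNReal.rpow_neg, ENNReal.rpow_neg]
          exact ENNReal.inv_le_inv.2 (ENNReal.rpow_le_rpow h h0.le)
  refine ⟨C₁.toNNReal, fun x ρ hρ => ?_⟩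
  rw [ENNReal.coe_toNNReal hCt]
  -- A ball near the origin sits in `closedBall 0 (3 * ρ)`, where the integral scales exactly; on a
  -- ball far from it, `‖y‖ ≥ ‖x‖ / 2` makes the weight essentially constant. The two terms of `C₁`
  -- serve these two cases.
  by_cases hx : ‖x‖ < 2 * ρ
  · have hsub : closedBall x ρ ⊆ closedBall (0 : E) (3 * ρ) :=
      closedBall_subset_closedBall' (by rw [dist_zero_right]; linarith)
    have hmax : max (ENNReal.ofReal ρ) ‖x‖ₑ ≤ 2 * ENNReal.ofReal (3 * ρ) := by
      refine max_le ?_ ?_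
      · rw [← ENNReal.ofReal_ofNat 2, ← ENNReal.ofReal_mul (by norm_num)]
        exact ENNReal.ofReal_le_ofReal (by linarith)
      · rw [← ENNReal.ofReal_ofNat 2, ← ENNReal.ofReal_mul (by norm_num), ← ofReal_norm]
        exact ENNReal.ofReal_le_ofReal (by linarith)
    refine (lintegral_mono_set hsub).trans ?_
    rw [lintegral_closedBall_zero_enorm_rpow μ α (by positivity), ← hI,
      Measure.addHaar_closedBall μ x hρ.le, mul_pow, ENNReal.ofReal_mul (by positivity)]
    calc ENNReal.ofReal (3 ^ finrank ℝ E) * ENNReal.ofReal (ρ ^ finrank ℝ E) *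
          (ENNReal.ofReal (3 * ρ) ^ (-α) * I)
        ≤ ENNReal.ofReal (3 ^ finrank ℝ E) * ENNReal.ofReal (ρ ^ finrank ℝ E) *
          (2 ^ α * max (ENNReal.ofReal ρ) ‖x‖ₑ ^ (-α) * I) := by
          gcongr
          exact hhalf _ _ hmax
      _ = (3 ^ finrank ℝ E * (2 ^ α * (I / μ (ball (0 : E) 1)))) *
          max (ENNReal.ofReal ρ) ‖x‖ₑ ^ (-α) *
          (ENNReal.ofReal (ρ ^ finrank ℝ E) * μ (ball (0 : E) 1)) := by
          have e3 : ENNReal.ofReal (3 ^ finrank ℝ E) = 3 ^ finrank ℝ E := by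
            rw [ENNReal.ofReal_pow (by norm_num)]; norm_num
          have e4 : I = I / μ (ball (0 : E) 1) * μ (ball (0 : E) 1) :=
            (ENNReal.div_mul_cancel hω0 hωt).symm
          rw [e3]
          nth_rewrite 1 [e4]
          ring
      _ ≤ _ := by gcongr; exact le_self_add
  · push Not at hx
    have hle : ∀ y ∈ closedBall x ρ, ‖y‖ₑ ^ (-α) ≤
        2 ^ α * max (ENNReal.ofReal ρ) ‖x‖ₑ ^ (-α) := by
      intro y hy
      refine hhalf _ _ (max_le ?_ ?_)
      all_goals
        rw [mem_closedBall, dist_comm, dist_eq_norm] at hy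
        have := norm_sub_norm_le x y
        rw [← ofReal_norm y, ← ENNReal.ofReal_ofNat 2, ← ENNReal.ofReal_mul (by norm_num)]
      · exact ENNReal.ofReal_le_ofReal (by linarith)
      · rw [← ofReal_norm]
        exact ENNReal.ofReal_le_ofReal (by linarith)
    refine (setLIntegral_mono measurable_const hle).trans ?_
    rw [setLIntegral_const]
    gcongr
    exact le_add_self

end PowerWeights

/-- Hölder's inequality in terms of averages. -/
lemma lintegral_mul_le_of_lintegral_rpow_le {X : Type*} [MeasurableSpace X] {ν : Measure X}
    {f g : X → ℝ≥0∞} {p q : ℝ} (hpq : p.HolderConjugate q) (hf : AEMeasurable f ν)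
    (hg : AEMeasurable g ν) {A B V : ℝ≥0∞} (hA : ∫⁻ x, f x ^ p ∂ν ≤ A ^ p * V)
    (hB : ∫⁻ x, g x ^ q ∂ν ≤ B ^ q * V) :
    ∫⁻ x, f x * g x ∂ν ≤ A * B * V := by
  have hp := hpq.pos
  have hq := hpq.symm.pos
  have e : ∀ (Z : ℝ≥0∞) (t : ℝ), 0 < t → (Z ^ t * V) ^ (1 / t) = Z * V ^ (1 / t) := by
    intro Z t ht
    rw [ENNReal.mul_rpow_of_nonneg _ _ (by positivity), ← ENNReal.rpow_mul, mul_one_div_cancel ht.ne',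
      ENNReal.rpow_one]
  calc ∫⁻ x, f x * g x ∂ν
      ≤ (∫⁻ x, f x ^ p ∂ν) ^ (1 / p) * (∫⁻ x, g x ^ q ∂ν) ^ (1 / q) :=
        ENNReal.lintegral_mul_le_Lp_mul_Lq ν hpq hf hg
    _ ≤ (A ^ p * V) ^ (1 / p) * (B ^ q * V) ^ (1 / q) := by gcongr
    _ = A * B * (V ^ (1 / p) * V ^ (1 / q)) := by rw [e A p hp, e B q hq]; ring
    _ = A * B * V := by
        rw [← ENNReal.rpow_add_of_nonneg _ _ (by positivity) (by positivity), one_div, one_div,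
          hpq.inv_add_inv_eq_one, ENNReal.rpow_one]

/-- The linear drift of the means over `i` doublings loses to the geometric decay of the weight;
Bernoulli's inequality gives the constant. -/
lemma exists_natCast_mul_two_pow_rpow_neg_le {α : ℝ} (hα : 0 < α) :
    ∃ C : ℝ≥0, ∀ i : ℕ, (i : ℝ≥0∞) * (2 ^ i) ^ (-α) ≤ C := by
  have h1 : (1 : ℝ) < 2 ^ α := Real.one_lt_rpow (by norm_num) hα
  refine ⟨Real.toNNReal (2 ^ α - 1)⁻¹, fun i => ?_⟩
  have h2 : 1 + (i : ℝ) * (2 ^ α - 1) ≤ (1 + (2 ^ α - 1)) ^ i :=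
    one_add_mul_le_pow (by linarith) i
  have e : ((2 : ℝ≥0∞) ^ i) ^ (-α) = ENNReal.ofReal (((2 ^ α) ^ i)⁻¹) := by
    rw [ENNReal.ofReal_inv_of_pos (by positivity), ENNReal.ofReal_pow (by positivity),
      ← ENNReal.ofReal_rpow_of_pos (by norm_num), ENNReal.rpow_neg, ← ENNReal.rpow_natCast,
      ← ENNReal.rpow_natCast, ← ENNReal.rpow_mul, ← ENNReal.rpow_mul, mul_comm]
    norm_num
  rw [e, ← ENNReal.ofReal_natCast, ← ENNReal.ofReal_mul (by positivity)]
  refine ENNReal.ofReal_le_ofReal ?_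
  rw [← div_eq_mul_inv, div_le_iff₀ (by positivity), inv_mul_eq_div, le_div_iff₀ (by linarith)]
  have h3 : (1 + (2 ^ α - 1) : ℝ) = 2 ^ α := by ring
  rw [h3] at h2
  linarith

/-! ### Commutator averages of power weights over balls. -/

section CommutatorOnBalls

variable {E : Type*} [NormedAddCommGroup E] [NormedSpace ℝ E] [FiniteDimensional ℝ E]
  [MeasurableSpace E] [BorelSpace E] (μ : Measure E) [μ.IsAddHaarMeasure]

lemma ENNReal.rpow_neg_anti {a c : ℝ≥0∞} {α : ℝ} (hα : 0 ≤ α) (h : a ≤ c) :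
    c ^ (-α) ≤ a ^ (-α) := by
  rw [ENNReal.rpow_neg, ENNReal.rpow_neg]
  exact ENNReal.inv_le_inv.2 (ENNReal.rpow_le_rpow h hα)

/-- Lets a constant outside a power be absorbed into its base. -/
lemma ENNReal.coe_le_add_one_rpow (C : ℝ≥0) {e : ℝ} (he : 1 ≤ e) :
    (C : ℝ≥0∞) ≤ (C + 1) ^ e := by
  calc (C : ℝ≥0∞) ≤ (C + 1) ^ (1 : ℝ) := by rw [ENNReal.rpow_one]; exact le_self_add
    _ ≤ (C + 1) ^ e := ENNReal.rpow_le_rpow_of_exponent_le le_add_self he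

/-- Oscillation against a power weight. -/
lemma exists_lintegral_enorm_sub_ballAvg_mul_enorm_rpow_le {α : ℝ} (h0 : 0 < α)
    (hα : α < finrank ℝ E) :
    ∃ C : ℝ≥0, ∀ (b : E → ℝ) (K : ℝ≥0), LocallyIntegrable b μ → BallOscLE μ b K → 0 < K →
      ∀ (x : E) (ρ : ℝ), 0 < ρ →
        ∫⁻ y in closedBall x ρ, ‖b y - ballAvg μ b x ρ‖ₑ * ‖y‖ₑ ^ (-α) ∂μ ≤
          C * K * max (ENNReal.ofReal ρ) ‖x‖ₑ ^ (-α) * μ (closedBall x ρ) := by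
  -- The strict inequality `α < d` leaves room for a Hölder exponent `q > 1` with `q * α < d`; the
  -- oscillation takes the conjugate exponent, which John–Nirenberg allows however large it is.
  obtain ⟨q, hq1, hq2⟩ := exists_between ((one_lt_div h0).2 hα)
  rw [lt_div_iff₀ h0] at hq2
  have hq0 : 0 < q := by linarith
  have hpq := Real.HolderConjugate.conjExponent hq1
  set p := q.conjExponent with hp
  have hp1 : 1 < p := hpq.symm.lt
  obtain ⟨D, hD⟩ := exists_lintegral_dyadicMaxOsc_rpow_le μ hp1.le
  obtain ⟨C, hC⟩ := exists_lintegral_closedBall_enorm_rpow_le μ (mul_pos hq0 h0) hq2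
  refine ⟨D * (C + 1), fun b K hb hK hK0 x ρ hρ => ?_⟩
  have h1 : ∫⁻ y in closedBall x ρ, ‖b y - ballAvg μ b x ρ‖ₑ ^ p ∂μ ≤
      (D * K) ^ p * μ (closedBall x ρ) := by
    refine le_trans (lintegral_mono_ae ?_) (hD b K hb hK hK0 x ρ hρ)
    filter_upwards [ae_restrict_of_ae (ae_enorm_sub_ballAvg_le_dyadicMaxOsc hb)] with y hy
    exact ENNReal.rpow_le_rpow (hy x ρ hρ) (by linarith)
  have h2 : ∫⁻ y in closedBall x ρ, (‖y‖ₑ ^ (-α)) ^ q ∂μ ≤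
      ((C + 1) * max (ENNReal.ofReal ρ) ‖x‖ₑ ^ (-α)) ^ q * μ (closedBall x ρ) := by
    have e : ∀ z : ℝ≥0∞, (z ^ (-α)) ^ q = z ^ (-(q * α)) := fun z => by
      rw [← ENNReal.rpow_mul]; congr 1; ring
    simp_rw [ENNReal.mul_rpow_of_nonneg _ _ hq0.le, e]
    refine (hC x ρ hρ).trans ?_
    gcongr
    exact ENNReal.coe_le_add_one_rpow C hq1.le
  refine (lintegral_mul_le_of_lintegral_rpow_le hpq.symm
    (hb.aestronglyMeasurable.aemeasurable.sub_const _).enorm.restrict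
    (measurable_enorm.pow_const _).aemeasurable h1 h2).trans_eq ?_
  push_cast
  ring

-- Each doubling moves the mean by at most `2 ^ d * K`, and the steps telescope.
variable {μ} in
lemma enorm_ballAvg_sub_ballAvg_two_pow_le {b : E → ℝ} {K : ℝ≥0} (hb : LocallyIntegrable b μ)
    (hK : BallOscLE μ b K) (x : E) {r : ℝ} (hr : 0 < r) (i : ℕ) :
    ‖ballAvg μ b x r - ballAvg μ b x (2 ^ i * r)‖ₑ ≤ i * (2 ^ finrank ℝ E * K) := by
  induction i with
  | zero => simp
  | succ i ih =>
    have h := enorm_ballAvg_sub_ballAvg_le hb hK (x := x) (c := x) (s := 2 ^ i * r) (by positivity) 1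
      (closedBall_subset_closedBall (by linarith [show 0 < 2 ^ i * r by positivity]))
    rw [← mul_assoc, ← pow_add, add_comm 1 i, one_mul] at h
    refine (enorm_sub_le_add _ (ballAvg μ b x (2 ^ i * r)) _).trans ((add_le_add ih h).trans_eq ?_)
    push_cast
    ring

/-- The commutator averages of a power weight over balls centred at `x` are controlled by the
dyadic maximal deviation relative to any ball containing `x`. -/
lemma exists_lintegral_enorm_sub_mul_enorm_rpow_le {α : ℝ} (h0 : 0 < α) (hα : α < finrank ℝ E) :
    ∃ C : ℝ≥0, ∀ (b : E → ℝ) (K : ℝ≥0), LocallyIntegrable b μ → BallOscLE μ b K → 0 < K →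
      ∀ᵐ x ∂μ, ∀ (c : E) (r : ℝ), 0 < r → x ∈ closedBall c r → ∀ k : ℤ,
        ∫⁻ y in closedBall x (2 ^ k * r), ‖b x - b y‖ₑ * ‖y‖ₑ ^ (-α) ∂μ ≤
          C * ((dyadicMaxOsc μ b c r x + K) * (‖x‖ₑ ^ (-α) + ENNReal.ofReal r ^ (-α))) *
            μ (closedBall x (2 ^ k * r)) := by
  obtain ⟨C₁, hC₁⟩ := exists_lintegral_closedBall_enorm_rpow_le μ h0 hα
  obtain ⟨C₂, hC₂⟩ := exists_lintegral_enorm_sub_ballAvg_mul_enorm_rpow_le μ h0 hα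
  obtain ⟨C₃, hC₃⟩ := exists_natCast_mul_two_pow_rpow_neg_le h0
  refine ⟨2 * C₁ + C₁ * C₃ * 2 ^ finrank ℝ E + C₂, fun b K hb hK hK0 => ?_⟩
  filter_upwards [ae_enorm_sub_ballAvg_le_dyadicMaxOsc hb] with x hx c r hr hxc k
  set S := dyadicMaxOsc μ b c r x with hS
  set ρ : ℝ := 2 ^ k * r with hρdef
  have hρ : 0 < ρ := by positivity
  set M := max (ENNReal.ofReal ρ) ‖x‖ₑ ^ (-α) with hM
  set W := ‖x‖ₑ ^ (-α) + ENNReal.ofReal r ^ (-α) with hW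
  have hsplit : ∫⁻ y in closedBall x ρ, ‖b x - b y‖ₑ * ‖y‖ₑ ^ (-α) ∂μ ≤
      (C₁ * (‖b x - ballAvg μ b x ρ‖ₑ * M) + C₂ * (K * M)) * μ (closedBall x ρ) := by
    calc _ ≤ ∫⁻ y in closedBall x ρ, (‖b x - ballAvg μ b x ρ‖ₑ * ‖y‖ₑ ^ (-α) +
            ‖b y - ballAvg μ b x ρ‖ₑ * ‖y‖ₑ ^ (-α)) ∂μ := by
          refine lintegral_mono fun y => ?_
          rw [← add_mul]
          gcongr
          exact enorm_sub_le_add' _ _ _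
      _ = ‖b x - ballAvg μ b x ρ‖ₑ * ∫⁻ y in closedBall x ρ, ‖y‖ₑ ^ (-α) ∂μ +
            ∫⁻ y in closedBall x ρ, ‖b y - ballAvg μ b x ρ‖ₑ * ‖y‖ₑ ^ (-α) ∂μ := by
          rw [lintegral_add_left ((measurable_enorm.pow_const _).const_mul _),
            lintegral_const_mul _ (measurable_enorm.pow_const _)]
      _ ≤ ‖b x - ballAvg μ b x ρ‖ₑ * (C₁ * M * μ (closedBall x ρ)) +
            C₂ * K * M * μ (closedBall x ρ) := by
          gcongr
          · exact hC₁ x ρ hρ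
          · exact hC₂ b K hb hK hK0 x ρ hρ
      _ = _ := by ring
  have hMx : M ≤ ‖x‖ₑ ^ (-α) := ENNReal.rpow_neg_anti h0.le (le_max_right _ _)
  have hMρ : M ≤ ENNReal.ofReal ρ ^ (-α) := ENNReal.rpow_neg_anti h0.le (le_max_left _ _)
  have hMW : M ≤ W := hMx.trans le_self_add
  -- For `k ≥ 0` the deviation is at most `2 * S` plus a drift linear in `k`, paid for by `M ≤ (2 ^
  -- k * r) ^ (-α)`. For `k ≤ 0` the ball is one of the dyadic scales in `S`, so `2 * S` suffices.
  have hmain : ‖b x - ballAvg μ b x ρ‖ₑ * M ≤ 2 * S * W + C₃ * 2 ^ finrank ℝ E * K * W := by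
    rcases le_total 0 k with hk | hk
    · lift k to ℕ using hk
      rw [zpow_natCast] at hρdef
      have h1 : ‖b x - ballAvg μ b x ρ‖ₑ ≤ 2 * S + k * (2 ^ finrank ℝ E * K) := by
        have e0 : ‖ballAvg μ b c r - ballAvg μ b x r‖ₑ ≤ S := by
          rw [enorm_sub_rev]
          exact le_iSup_of_le (f := fun j : ℕ => ‖ballAvg μ b x (r / 2 ^ j) - ballAvg μ b c r‖ₑ) 0
            (by simp)
        have e1 : ‖b x - ballAvg μ b x r‖ₑ ≤ S + S :=
          (enorm_sub_le_add _ (ballAvg μ b c r) _).trans (add_le_add (hx c r hr) e0)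
        refine (enorm_sub_le_add _ (ballAvg μ b x r) _).trans ?_
        rw [two_mul, hρdef]
        exact add_le_add e1 (enorm_ballAvg_sub_ballAvg_two_pow_le hb hK x hr k)
      have h2 : (k : ℝ≥0∞) * M ≤ C₃ * W := by
        have e2 : ENNReal.ofReal ρ ^ (-α) = (2 ^ k) ^ (-α) * ENNReal.ofReal r ^ (-α) := by
          rw [hρdef, ENNReal.ofReal_mul (by positivity), ENNReal.ofReal_pow (by norm_num),
            ENNReal.ofReal_ofNat, ENNReal.mul_rpow_of_ne_top (by simp) ENNReal.ofReal_ne_top]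
        calc (k : ℝ≥0∞) * M ≤ k * ((2 ^ k) ^ (-α) * ENNReal.ofReal r ^ (-α)) := by
              gcongr; exact hMρ.trans_eq e2
          _ = (k * (2 ^ k) ^ (-α)) * ENNReal.ofReal r ^ (-α) := by ring
          _ ≤ C₃ * W := by
              gcongr
              · exact hC₃ k
              · exact le_add_self
      calc _ ≤ (2 * S + k * (2 ^ finrank ℝ E * K)) * M := by gcongr
        _ = 2 * S * M + 2 ^ finrank ℝ E * K * (k * M) := by ring
        _ ≤ 2 * S * W + 2 ^ finrank ℝ E * K * (C₃ * W) := by gcongr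
        _ = _ := by ring
    · obtain ⟨j, rfl⟩ : ∃ j : ℕ, k = -j := ⟨k.natAbs, by omega⟩
      have e3 : ρ = r / 2 ^ j := by rw [hρdef, zpow_neg, zpow_natCast, inv_mul_eq_div]
      refine le_add_right ?_
      gcongr
      rw [two_mul]
      refine (enorm_sub_le_add' _ (ballAvg μ b c r) _).trans (add_le_add (hx c r hr) ?_)
      rw [e3]
      exact le_iSup (fun j : ℕ => ‖ballAvg μ b x (r / 2 ^ j) - ballAvg μ b c r‖ₑ) j
  refine hsplit.trans ?_
  gcongr
  calc _ ≤ C₁ * (2 * S * W + C₃ * 2 ^ finrank ℝ E * K * W) + C₂ * (K * W) := by gcongr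
    _ = 2 * C₁ * (S * W) + (C₁ * C₃ * 2 ^ finrank ℝ E + C₂) * (K * W) := by ring
    _ ≤ 2 * C₁ * (S * W) + (C₁ * C₃ * 2 ^ finrank ℝ E + C₂) * (K * W) +
        ((C₁ * C₃ * 2 ^ finrank ℝ E + C₂) * (S * W) + 2 * C₁ * (K * W)) := le_self_add
    _ = _ := by push_cast; ring

/-- A crude Minkowski inequality, by convexity of `t ^ e`: it adds the constants `K` and `r ^ (-α)`
to functions whose averages are already of that size. -/
lemma lintegral_add_const_rpow_le {X : Type*} [MeasurableSpace X] {ν : Measure X} {g : X → ℝ≥0∞}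
    {e : ℝ} (he : 1 ≤ e) {A B : ℝ≥0∞} (h : ∫⁻ x, g x ^ e ∂ν ≤ (A * B) ^ e * ν univ) :
    ∫⁻ x, (g x + B) ^ e ∂ν ≤ (2 * (A + 1) * B) ^ e * ν univ := by
  have he0 : 0 ≤ e := by linarith
  have h2 : (2 : ℝ≥0∞) ^ (e - 1) ≠ ∞ :=
    ENNReal.rpow_ne_top_of_nonneg (by linarith) (by simp)
  have h3 : (2 : ℝ≥0∞) ^ (e - 1) * 2 = 2 ^ e := by
    nth_rewrite 2 [← ENNReal.rpow_one 2]
    rw [← ENNReal.rpow_add _ _ (by simp) (by simp), sub_add_cancel]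
  calc ∫⁻ x, (g x + B) ^ e ∂ν ≤ ∫⁻ x, 2 ^ (e - 1) * (g x ^ e + B ^ e) ∂ν :=
        lintegral_mono fun x => ENNReal.rpow_add_le_mul_rpow_add_rpow _ _ he
    _ = 2 ^ (e - 1) * (∫⁻ x, g x ^ e ∂ν + B ^ e * ν univ) := by
        rw [lintegral_const_mul' _ _ h2, lintegral_add_right _ measurable_const, lintegral_const]
    _ ≤ 2 ^ (e - 1) * ((A * B) ^ e * ν univ + B ^ e * ν univ) := by gcongr
    _ ≤ 2 ^ (e - 1) * (((A + 1) * B) ^ e * ν univ + ((A + 1) * B) ^ e * ν univ) := by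
        gcongr
        · exact le_self_add
        · exact le_mul_of_one_le_left' le_add_self
    _ = (2 ^ (e - 1) * 2) * ((A + 1) * B) ^ e * ν univ := by ring
    _ = _ := by rw [h3, ← ENNReal.mul_rpow_of_nonneg _ _ he0]; ring_nf

/-- Hölder with exponents `q'` and `q` on the `p`-th powers: the oscillation is integrated to the
power `p * q'`, the weight to the power `p * q`, hence the condition on `p * q * α`. -/
lemma exists_lintegral_dyadicMaxOsc_mul_weight_rpow_le {α p q : ℝ} (h0 : 0 < α) (hp : 1 ≤ p)
    (hq : 1 < q) (hα : p * q * α < finrank ℝ E) :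
    ∃ C : ℝ≥0, ∀ (b : E → ℝ) (K : ℝ≥0), LocallyIntegrable b μ → BallOscLE μ b K → 0 < K →
      ∀ (c : E) (r : ℝ), 0 < r →
        ∫⁻ x in closedBall c r,
          ((dyadicMaxOsc μ b c r x + K) * (‖x‖ₑ ^ (-α) + ENNReal.ofReal r ^ (-α))) ^ p ∂μ ≤
          (C * K * ENNReal.ofReal r ^ (-α)) ^ p * μ (closedBall c r) := by
  have hp0 : 0 < p := by linarith
  have hq0 : 0 < q := by linarith
  have hpq := (Real.HolderConjugate.conjExponent hq).symm
  set q' := q.conjExponent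
  have hq'1 : 1 < q' := hpq.lt
  have hpq1 : 1 ≤ p * q := one_le_mul_of_one_le_of_one_le hp hq.le
  have hpq'1 : 1 ≤ p * q' := one_le_mul_of_one_le_of_one_le hp hq'1.le
  obtain ⟨D, hD⟩ := exists_lintegral_dyadicMaxOsc_rpow_le μ hpq'1
  obtain ⟨C, hC⟩ := exists_lintegral_closedBall_enorm_rpow_le μ (mul_pos (mul_pos hp0 hq0) h0) hα
  refine ⟨2 * (D + 1) * (2 * (C + 1 + 1)), fun b K hb hK hK0 c r hr => ?_⟩
  have huniv : (μ.restrict (closedBall c r)) univ = μ (closedBall c r) := by simp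
  have h1 := hD b K hb hK hK0 c r hr
  rw [← huniv] at h1
  have h1' := lintegral_add_const_rpow_le hpq'1 h1
  have h2 : ∫⁻ x in closedBall c r, (‖x‖ₑ ^ (-α)) ^ (p * q) ∂μ ≤
      ((C + 1) * ENNReal.ofReal r ^ (-α)) ^ (p * q) * (μ.restrict (closedBall c r)) univ := by
    have e : ∀ z : ℝ≥0∞, (z ^ (-α)) ^ (p * q) = z ^ (-(p * q * α)) := fun z => by
      rw [← ENNReal.rpow_mul]; congr 1; ring
    simp_rw [ENNReal.mul_rpow_of_nonneg _ _ (zero_le_one.trans hpq1), e, huniv]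
    refine (hC c r hr).trans ?_
    gcongr ?_ * ?_ * _
    · exact ENNReal.coe_le_add_one_rpow C hpq1
    · exact ENNReal.rpow_neg_anti (by positivity) (le_max_left _ _)
  have h2' := lintegral_add_const_rpow_le hpq1 h2
  simp_rw [ENNReal.rpow_mul, huniv] at h1' h2'
  simp_rw [ENNReal.mul_rpow_of_nonneg _ _ hp0.le] at h1' h2' ⊢
  refine (lintegral_mul_le_of_lintegral_rpow_le hpq ?_ ?_ h1' h2').trans_eq ?_
  · exact (((measurable_dyadicMaxOsc hb.aestronglyMeasurable c r).add_const _).pow_const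
      p).aemeasurable
  · exact (((measurable_enorm.pow_const _).add_const _).pow_const p).aemeasurable
  · push_cast
    simp_rw [← ENNReal.mul_rpow_of_nonneg _ _ hp0.le]
    congr 2
    ring

end CommutatorOnBalls

/-! ### Geometry of cubes, and the passage between cubes and Euclidean balls. -/

section Cubes

variable {n : ℕ}

lemma isClosed_cube (a : EuclideanSpace ℝ (Fin n)) (ℓ : ℝ) : IsClosed (cube a ℓ) := by
  have : cube a ℓ = ⋂ i, {y : EuclideanSpace ℝ (Fin n) | a i ≤ y i ∧ y i ≤ a i + ℓ} := by
    ext y; simp [cube]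
  rw [this]
  refine isClosed_iInter fun i => ?_
  exact (isClosed_le continuous_const (EuclideanSpace.proj (𝕜 := ℝ) i).continuous).inter
    (isClosed_le (EuclideanSpace.proj (𝕜 := ℝ) i).continuous continuous_const)

lemma measurableSet_cube (a : EuclideanSpace ℝ (Fin n)) (ℓ : ℝ) : MeasurableSet (cube a ℓ) :=
  (isClosed_cube a ℓ).measurableSet

lemma volume_cube (a : EuclideanSpace ℝ (Fin n)) (ℓ : ℝ) :
    volume (cube a ℓ) = ENNReal.ofReal ℓ ^ n := by
  have h : cube a ℓ = (WithLp.ofLp : EuclideanSpace ℝ (Fin n) → Fin n → ℝ) ⁻¹'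
      Icc (WithLp.ofLp a) (fun i => a i + ℓ) := by
    ext y
    simp [cube, Pi.le_def, forall_and]
  rw [h, (PiLp.volume_preserving_ofLp (Fin n)).measure_preimage measurableSet_Icc.nullMeasurableSet,
    Real.volume_Icc_pi]
  simp

lemma volume_cube_ne_zero (a : EuclideanSpace ℝ (Fin n)) {ℓ : ℝ} (hℓ : 0 < ℓ) :
    volume (cube a ℓ) ≠ 0 := by
  rw [volume_cube]
  exact pow_ne_zero _ (by simpa using hℓ)

lemma volume_cube_ne_top (a : EuclideanSpace ℝ (Fin n)) (ℓ : ℝ) : volume (cube a ℓ) ≠ ∞ := by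
  rw [volume_cube]
  exact ENNReal.pow_ne_top ENNReal.ofReal_ne_top

lemma volume_cube_rpow (hn : n ≠ 0) (a : EuclideanSpace ℝ (Fin n)) (ℓ lam : ℝ) :
    volume (cube a ℓ) ^ (lam / (n : ℝ)) = ENNReal.ofReal ℓ ^ lam := by
  rw [volume_cube, ← ENNReal.rpow_natCast, ← ENNReal.rpow_mul]
  congr 1
  field_simp

lemma cube_subset_closedBall {a x : EuclideanSpace ℝ (Fin n)} {ℓ : ℝ} (hℓ : 0 ≤ ℓ)
    (hx : x ∈ cube a ℓ) : cube a ℓ ⊆ closedBall x (√n * ℓ) := by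
  intro y hy
  rw [mem_closedBall, EuclideanSpace.dist_eq]
  calc √(∑ i, dist (y i) (x i) ^ 2) ≤ √(∑ _i : Fin n, ℓ ^ 2) := by
        refine Real.sqrt_le_sqrt (Finset.sum_le_sum fun i _ => ?_)
        have h1 := hx i
        have h2 := hy i
        gcongr
        rw [Real.dist_eq, abs_le]
        constructor <;> linarith
    _ = √n * ℓ := by
        rw [Finset.sum_const, Finset.card_univ, Fintype.card_fin, nsmul_eq_mul,
          Real.sqrt_mul (by positivity), Real.sqrt_sq hℓ]

lemma self_mem_cube (a : EuclideanSpace ℝ (Fin n)) {ℓ : ℝ} (hℓ : 0 ≤ ℓ) : a ∈ cube a ℓ :=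
  fun i => ⟨le_rfl, by linarith⟩

lemma closedBall_subset_cube (c : EuclideanSpace ℝ (Fin n)) (r : ℝ) :
    closedBall c r ⊆ cube (WithLp.toLp 2 fun i => c i - r) (2 * r) := by
  intro y hy i
  have h1 : |y i - c i| ≤ r := by
    have := PiLp.norm_apply_le (y - c) i
    rw [mem_closedBall, dist_eq_norm] at hy
    simpa using this.trans hy
  rw [abs_le] at h1
  constructor
  · change c i - r ≤ y i; linarith
  · change y i ≤ c i - r + 2 * r; linarith

lemma volume_closedBall_eq_mul_volume_cube (c a : EuclideanSpace ℝ (Fin n)) {t ℓ : ℝ} (ht : 0 ≤ t)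
    (hℓ : 0 ≤ ℓ) :
    volume (closedBall c (t * ℓ)) = ENNReal.ofReal t ^ n *
      volume (ball (0 : EuclideanSpace ℝ (Fin n)) 1) * volume (cube a ℓ) := by
  rw [Measure.addHaar_closedBall _ _ (by positivity), volume_cube, finrank_euclideanSpace_fin,
    ENNReal.ofReal_pow (by positivity), ENNReal.ofReal_mul ht, mul_pow]
  ring

variable (n) in
/-- A bound for the mean oscillation over cubes gives one over Euclidean balls. -/
lemma exists_ballOscLE_of_bmoSeminorm_le :
    ∃ κ : ℝ≥0, 0 < κ ∧ ∀ (b : EuclideanSpace ℝ (Fin n) → ℝ) (K : ℝ≥0), LocallyIntegrable b volume →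
      bmoSeminorm b ≤ K → BallOscLE volume b (κ * K) := by
  have hω0 : volume (ball (0 : EuclideanSpace ℝ (Fin n)) 1) ≠ 0 := (measure_ball_pos _ _ one_pos).ne'
  have hωt : volume (ball (0 : EuclideanSpace ℝ (Fin n)) 1) ≠ ∞ := measure_ball_lt_top.ne
  set κ₀ : ℝ≥0∞ := 2 ^ n / volume (ball (0 : EuclideanSpace ℝ (Fin n)) 1) with hκ₀
  have hκt : κ₀ ≠ ∞ := ENNReal.div_ne_top (by simp) hω0
  have hκ0 : κ₀ ≠ 0 := ENNReal.div_ne_zero.2 ⟨by simp, hωt⟩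
  -- `κ₀` is the volume ratio of a cube to its inscribed ball; the `2` pays for replacing the cube
  -- mean by the ball mean.
  refine ⟨2 * κ₀.toNNReal, by have := ENNReal.toNNReal_pos hκ0 hκt; positivity, ?_⟩
  intro b K hb hbK c r hr
  set Q := cube (WithLp.toLp 2 fun i => c i - r) (2 * r) with hQ
  set m := ⨍ z in Q, b z ∂volume with hm
  have hvol : volume Q = κ₀ * volume (closedBall c r) := by
    rw [hQ, volume_cube, Measure.addHaar_closedBall _ _ hr.le, finrank_euclideanSpace_fin, hκ₀,
      ENNReal.ofReal_mul (by norm_num), ENNReal.ofReal_pow hr.le, mul_pow, mul_left_comm,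
      ENNReal.div_mul_cancel hω0 hωt]
    norm_num
    ring
  have h1 : ∫⁻ y in Q, ‖b y - m‖ₑ ≤ K * volume Q := by
    have h2 : (volume Q)⁻¹ * ∫⁻ y in Q, ‖b y - m‖ₑ ≤ K := by
      refine le_trans ?_ hbK
      rw [bmoSeminorm]
      exact le_iSup_of_le (WithLp.toLp 2 fun i => c i - r)
        (le_iSup₂_of_le (2 * r) (by positivity) le_rfl)
    rwa [mul_comm, ← div_eq_mul_inv, ENNReal.div_le_iff (volume_cube_ne_zero _ (by positivity))
      (volume_cube_ne_top _ _)] at h2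
  have h3 : ∫⁻ y in closedBall c r, ‖b y - m‖ₑ ≤ K * volume Q :=
    (lintegral_mono_set (closedBall_subset_cube c r)).trans h1
  have h4 := enorm_ballAvg_sub_mul_le hb c hr m
  calc ∫⁻ y in closedBall c r, ‖b y - ballAvg volume b c r‖ₑ
      ≤ ∫⁻ y in closedBall c r, (‖b y - m‖ₑ + ‖ballAvg volume b c r - m‖ₑ) :=
        lintegral_mono fun y => enorm_sub_le_add' _ _ _
    _ = (∫⁻ y in closedBall c r, ‖b y - m‖ₑ) +
          ‖ballAvg volume b c r - m‖ₑ * volume (closedBall c r) := by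
        rw [lintegral_add_right _ measurable_const, setLIntegral_const]
    _ ≤ K * volume Q + K * volume Q := add_le_add h3 (h4.trans h3)
    _ = _ := by
        rw [hvol]
        push_cast [ENNReal.coe_toNNReal hκt]
        ring

end Cubes

/-! ### The Young function, Luxemburg averages and the Morrey norm. -/

section Zygmund

variable {n : ℕ} {F : Type*} [ENorm F]

lemma le_zygmundYoung (t : ℝ≥0∞) : t ≤ zygmundYoung t :=
  le_mul_of_one_le_right' le_self_add

lemma toENNReal_log_le_rpow (t : ℝ≥0∞) {ε : ℝ} (hε : 0 < ε) :
    (ENNReal.log t).toENNReal ≤ t ^ ε * ENNReal.ofReal ε⁻¹ := by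
  rcases eq_or_ne t ∞ with rfl | ht
  · rw [ENNReal.top_rpow_of_pos hε, ENNReal.top_mul (by simpa using hε)]
    exact le_top
  rcases eq_or_ne t 0 with rfl | h0
  · simp
  · lift t to ℝ≥0 using ht
    have h0' : 0 < t := pos_iff_ne_zero.2 (by simpa using h0)
    rw [ENNReal.log_of_nnreal h0'.ne', EReal.toENNReal_of_ne_top (EReal.coe_ne_top _),
      EReal.toReal_coe, ← ENNReal.ofReal_coe_nnreal, ENNReal.ofReal_rpow_of_pos (by exact_mod_cast h0'),
      ← ENNReal.ofReal_mul (by positivity), ← div_eq_mul_inv]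
    exact ENNReal.ofReal_le_ofReal (Real.log_le_rpow_div t.2 hε)

/-- The logarithm is absorbed by `t ^ (p - 1)`. The linear term is at most `2⁻¹` for small `t` and
at most a power otherwise; `2⁻¹` spends only half of the bound `1` in the Luxemburg condition. -/
lemma exists_zygmundYoung_le {p : ℝ} (hp : 1 < p) :
    ∃ C : ℝ≥0, ∀ t : ℝ≥0∞, zygmundYoung t ≤ 2⁻¹ + C * t ^ p := by
  have hp0 : 0 < p := by linarith
  have h2t : (2 : ℝ≥0∞) ^ p ≠ ∞ := ENNReal.rpow_ne_top_of_nonneg hp0.le (by simp)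
  refine ⟨(2 ^ p : ℝ≥0) + Real.toNNReal (p - 1)⁻¹, fun t => ?_⟩
  have h1 : t ≤ 2⁻¹ + 2 ^ p * t ^ p := by
    rcases le_total t 2⁻¹ with h | h
    · exact le_add_right h
    · refine le_add_left ?_
      have h2 : 1 ≤ 2 * t := by
        calc (1 : ℝ≥0∞) = 2 * 2⁻¹ := (ENNReal.mul_inv_cancel (by simp) (by simp)).symm
          _ ≤ 2 * t := by gcongr
      rw [← ENNReal.mul_rpow_of_nonneg _ _ hp0.le]
      calc t ≤ (2 * t) ^ (1 : ℝ) := by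
            rw [ENNReal.rpow_one]; exact le_mul_of_one_le_left' (by norm_num)
        _ ≤ _ := ENNReal.rpow_le_rpow_of_exponent_le h2 hp.le
  have h3 : t * (ENNReal.log t).toENNReal ≤ ENNReal.ofReal (p - 1)⁻¹ * t ^ p := by
    have h4 : t * t ^ (p - 1) = t ^ p := by
      nth_rewrite 1 [← ENNReal.rpow_one t]
      rw [← ENNReal.rpow_add_of_nonneg _ _ (by norm_num) (by linarith)]
      congr 1; ring
    calc _ ≤ t * (t ^ (p - 1) * ENNReal.ofReal (p - 1)⁻¹) := by
          gcongr
          exact toENNReal_log_le_rpow t (by linarith)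
      _ = _ := by rw [← mul_assoc, h4, mul_comm]
  rw [zygmundYoung, mul_add, mul_one]
  refine (add_le_add h1 h3).trans_eq ?_
  push_cast [ENNReal.coe_rpow_of_nonneg _ hp0.le]
  rw [ENNReal.ofReal, add_mul, add_assoc]

/-- `L^p` averages with `p > 1` dominate `L(1 + log⁺ L)` averages. -/
lemma exists_zygmundAverage_le {p : ℝ} (hp : 1 < p) :
    ∃ C : ℝ≥0, ∀ (g : EuclideanSpace ℝ (Fin n) → F) (Q : Set (EuclideanSpace ℝ (Fin n)))
      (A : ℝ≥0∞), volume Q ≠ 0 → volume Q ≠ ∞ → ∫⁻ y in Q, ‖g y‖ₑ ^ p ≤ A ^ p * volume Q →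
        zygmundAverage g Q ≤ C * A := by
  obtain ⟨C, hC⟩ := exists_zygmundYoung_le hp
  have hp0 : 0 < p := by linarith
  refine ⟨2 * C + 1, fun g Q A hQ0 hQt hA => ?_⟩
  -- Admissible parameters must be positive and finite, whereas the target bound may be `0` or `∞`;
  -- hence the test with `β` strictly above it.
  refine le_of_forall_gt fun α hα => ?_
  obtain ⟨β, hAβ, hβα⟩ := exists_between hα
  have hβ0 : β ≠ 0 := (bot_le.trans_lt hAβ).ne'
  have hβt : β ≠ ∞ := (hβα.trans_le le_top).ne
  refine lt_of_le_of_lt (sInf_le ⟨pos_iff_ne_zero.2 hβ0, hβt.lt_top, ?_⟩) hβα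
  have hβp0 : β ^ p ≠ 0 := (ENNReal.rpow_pos (pos_iff_ne_zero.2 hβ0) hβt).ne'
  have hβpt : β ^ p ≠ ∞ := ENNReal.rpow_ne_top_of_nonneg hp0.le hβt
  have h1 : C * (A ^ p / β ^ p) ≤ 2⁻¹ := by
    have h2 : 2 * C * A ^ p ≤ β ^ p := by
      calc 2 * C * A ^ p ≤ (2 * C + 1) ^ p * A ^ p := by
            gcongr
            exact_mod_cast ENNReal.coe_le_add_one_rpow (2 * C) hp.le
        _ = ((2 * C + 1) * A) ^ p := (ENNReal.mul_rpow_of_nonneg _ _ hp0.le).symm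
        _ ≤ β ^ p := by
            gcongr
            exact_mod_cast hAβ.le
    rw [← mul_div_assoc]
    refine ENNReal.div_le_of_le_mul ?_
    calc C * A ^ p = 2⁻¹ * (2 * C * A ^ p) := by
          rw [mul_assoc, ← mul_assoc 2⁻¹, ENNReal.inv_mul_cancel (by simp) (by simp), one_mul]
      _ ≤ _ := by gcongr
  have h3 : ∫⁻ y in Q, zygmundYoung (‖g y‖ₑ / β) ≤ volume Q := by
    calc _ ≤ ∫⁻ y in Q, (2⁻¹ + C / β ^ p * ‖g y‖ₑ ^ p) := by
          refine lintegral_mono fun y => (hC _).trans_eq ?_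
          rw [ENNReal.div_rpow_of_nonneg _ _ hp0.le, ← mul_div_assoc, ENNReal.mul_div_right_comm]
      _ = 2⁻¹ * volume Q + C / β ^ p * ∫⁻ y in Q, ‖g y‖ₑ ^ p := by
          rw [lintegral_add_left measurable_const, setLIntegral_const,
            lintegral_const_mul' _ _ (ENNReal.div_ne_top (by simp) hβp0)]
      _ ≤ 2⁻¹ * volume Q + C / β ^ p * (A ^ p * volume Q) := by gcongr
      _ = (2⁻¹ + C * (A ^ p / β ^ p)) * volume Q := by
          simp only [div_eq_mul_inv]
          ring
      _ ≤ (2⁻¹ + 2⁻¹) * volume Q := by gcongr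
      _ = volume Q := by rw [ENNReal.inv_two_add_inv_two, one_mul]
  calc _ ≤ (volume Q)⁻¹ * volume Q := by gcongr
    _ = 1 := ENNReal.inv_mul_cancel hQ0 hQt

/-- Since `Φ(t) ≥ t`, every admissible `α` bounds the mean of `|g|`, hence any lower bound of `|g|`.
-/
lemma le_zygmundAverage_of_ae_le {g : EuclideanSpace ℝ (Fin n) → F}
    {Q : Set (EuclideanSpace ℝ (Fin n))} {δ : ℝ≥0∞} (hQ0 : volume Q ≠ 0) (hQt : volume Q ≠ ∞)
    (h : ∀ᵐ y ∂(volume.restrict Q), δ ≤ ‖g y‖ₑ) : δ ≤ zygmundAverage g Q := by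
  refine le_sInf ?_
  rintro α ⟨hα0, hαt, hα⟩
  have h1 : δ / α ≤ 1 := by
    refine le_trans ?_ hα
    have h2 : δ / α * volume Q ≤ ∫⁻ y in Q, zygmundYoung (‖g y‖ₑ / α) := by
      rw [← setLIntegral_const]
      refine lintegral_mono_ae ?_
      filter_upwards [h] with y hy
      exact (ENNReal.div_le_div_right hy α).trans (le_zygmundYoung _)
    calc δ / α = (volume Q)⁻¹ * (δ / α * volume Q) := by
          rw [mul_comm (δ / α), ← mul_assoc, ENNReal.inv_mul_cancel hQ0 hQt, one_mul]
      _ ≤ _ := by gcongr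
  exact (ENNReal.div_le_iff hα0.ne' hαt.ne).1 h1 |>.trans_eq (one_mul _)

lemma mul_ofReal_rpow_le_zygmundMorreyNorm (hn : n ≠ 0) (lam : ℝ)
    {g : EuclideanSpace ℝ (Fin n) → F} (a : EuclideanSpace ℝ (Fin n)) {ℓ : ℝ} (hℓ : 0 < ℓ)
    {δ : ℝ≥0∞} (h : ∀ᵐ y ∂(volume.restrict (cube a ℓ)), δ ≤ ‖g y‖ₑ) :
    ENNReal.ofReal ℓ ^ lam * δ ≤ zygmundMorreyNorm lam g := by
  refine le_trans ?_ (le_iSup_of_le a (le_iSup₂_of_le ℓ hℓ le_rfl))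
  rw [volume_cube_rpow hn]
  gcongr
  exact le_zygmundAverage_of_ae_le (volume_cube_ne_zero a hℓ) (volume_cube_ne_top a ℓ) h

end Zygmund

/-! ### Measurability of the maximal commutator, and its pointwise and `L^p` bounds. -/

section Commutator

variable {n : ℕ}

/-- Every cube lies in slightly larger cubes with rational corner and side length. -/
lemma exists_rat_cube_supset (a : EuclideanSpace ℝ (Fin n)) (ℓ : ℝ) {ε : ℝ} (hε : 0 < ε) :
    ∃ (a' : Fin n → ℚ) (ℓ' : ℚ), ℓ < ℓ' ∧ (ℓ' : ℝ) < ℓ + ε ∧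
      cube a ℓ ⊆ cube (WithLp.toLp 2 fun i => (a' i : ℝ)) ℓ' := by
  have h1 : ∀ i, ∃ q : ℚ, a i - ε / 2 < q ∧ (q : ℝ) < a i := fun i =>
    exists_rat_btwn (by linarith)
  choose a' ha' using h1
  obtain ⟨ℓ', hℓ1, hℓ2⟩ := exists_rat_btwn (show ℓ + ε / 2 < ℓ + ε by linarith)
  refine ⟨a', ℓ', by linarith, hℓ2, fun y hy i => ?_⟩
  have h2 := ha' i
  have h3 := hy i
  constructor
  · change (a' i : ℝ) ≤ y i; linarith
  · change y i ≤ a' i + ℓ'; linarith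

/-- The supremum over all cubes equals that over cubes with rational data: enlarging the cube
increases the integral, and its volume can be kept arbitrarily close. Each rational term is
measurable by Tonelli. -/
lemma aemeasurable_maximalCommutator {b f : EuclideanSpace ℝ (Fin n) → ℝ}
    (hb : AEMeasurable b volume) (hf : AEMeasurable f volume) :
    AEMeasurable (maximalCommutator b f) volume := by
  set Q : (Fin n → ℚ) × ℚ → Set (EuclideanSpace ℝ (Fin n)) :=
    fun q => cube (WithLp.toLp 2 fun i => (q.1 i : ℝ)) q.2 with hQ
  set G : EuclideanSpace ℝ (Fin n) → ℝ≥0∞ := fun x => ⨆ (q : (Fin n → ℚ) × ℚ) (_ : 0 < q.2),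
    (Q q).indicator (fun x => (volume (Q q))⁻¹ *
      ∫⁻ y in Q q, ‖hb.mk b x - hb.mk b y‖ₑ * ‖hf.mk f y‖ₑ ∂volume) x with hG
  have hGm : Measurable G := by
    refine Measurable.iSup fun q => Measurable.iSup fun _ => ?_
    refine Measurable.indicator ?_ (measurableSet_cube _ _)
    refine Measurable.const_mul ?_ _
    refine Measurable.lintegral_prod_right'
      (f := fun p : EuclideanSpace ℝ (Fin n) × EuclideanSpace ℝ (Fin n) =>
        ‖hb.mk b p.1 - hb.mk b p.2‖ₑ * ‖hf.mk f p.2‖ₑ) ?_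
    exact ((hb.measurable_mk.comp measurable_fst).sub
      (hb.measurable_mk.comp measurable_snd)).enorm.mul
      (hf.measurable_mk.comp measurable_snd).enorm
  refine ⟨G, hGm, ?_⟩
  filter_upwards [hb.ae_eq_mk] with x hx
  have hint : ∀ s : Set (EuclideanSpace ℝ (Fin n)),
      ∫⁻ y in s, ‖b x - b y‖ₑ * ‖f y‖ₑ = ∫⁻ y in s, ‖hb.mk b x - hb.mk b y‖ₑ * ‖hf.mk f y‖ₑ := by
    intro s
    refine lintegral_congr_ae ?_
    filter_upwards [ae_restrict_of_ae hb.ae_eq_mk, ae_restrict_of_ae hf.ae_eq_mk] with y h1 h2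
    rw [hx, h1, h2]
  have hterm : ∀ q : (Fin n → ℚ) × ℚ, 0 < q.2 → x ∈ Q q →
      (volume (Q q))⁻¹ * ∫⁻ y in Q q, ‖b x - b y‖ₑ * ‖f y‖ₑ ≤ G x := by
    intro q hq hxq
    refine le_iSup₂_of_le q hq ?_
    rw [indicator_of_mem hxq, hint]
  refine le_antisymm ?_ ?_
  · refine iSup_le fun a => iSup_le fun ℓ => iSup_le fun hℓ => iSup_le fun hxa => ?_
    set I := ∫⁻ y in cube a ℓ, ‖b x - b y‖ₑ * ‖f y‖ₑ with hI
    have hε : ∀ ε : ℝ, 0 < ε → (ENNReal.ofReal (ℓ + ε) ^ n)⁻¹ * I ≤ G x := by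
      intro ε hε
      obtain ⟨a', ℓ', h1, h2, h3⟩ := exists_rat_cube_supset a ℓ hε
      refine le_trans ?_ (hterm (a', ℓ') (by exact_mod_cast hℓ.trans h1) (h3 hxa))
      refine mul_le_mul' ?_ (lintegral_mono_set h3)
      rw [volume_cube]
      gcongr
    have hlim : Tendsto (fun ε : ℝ => (ENNReal.ofReal (ℓ + ε) ^ n)⁻¹ * I) (𝓝[>] 0)
        (𝓝 ((volume (cube a ℓ))⁻¹ * I)) := by
      refine ENNReal.Tendsto.mul_const ?_ (Or.inl ?_)
      · rw [volume_cube]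
        have h4 : Continuous fun ε : ℝ => (ENNReal.ofReal (ℓ + ε) ^ n)⁻¹ :=
          (((ENNReal.continuous_pow n).comp (ENNReal.continuous_ofReal.comp
            (continuous_const.add continuous_id)))).inv
        have h5 := h4.tendsto 0
        rw [add_zero] at h5
        exact h5.mono_left nhdsWithin_le_nhds
      -- The limit of the first factor is nonzero, so the product converges even when `I = ∞`.
      · exact ENNReal.inv_ne_zero.2 (volume_cube_ne_top a ℓ)
    exact le_of_tendsto hlim (eventually_mem_nhdsWithin.mono fun ε hε' => hε ε hε')
  · refine iSup_le fun q => iSup_le fun hq => ?_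
    by_cases hxq : x ∈ Q q
    · rw [indicator_of_mem hxq, ← hint]
      exact le_iSup_of_le _ (le_iSup_of_le (q.2 : ℝ)
        (le_iSup₂_of_le (by exact_mod_cast hq) hxq le_rfl))
    · rw [indicator_of_notMem hxq]
      exact bot_le

/-- Pointwise bound for the maximal commutator of a function dominated by a power weight. -/
lemma exists_maximalCommutator_le {α : ℝ} (h0 : 0 < α) (hα : α < n) :
    ∃ C : ℝ≥0, ∀ (b : EuclideanSpace ℝ (Fin n) → ℝ) (K : ℝ≥0), LocallyIntegrable b volume →
      BallOscLE volume b K → 0 < K →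
        ∀ᵐ x : EuclideanSpace ℝ (Fin n), ∀ (f : EuclideanSpace ℝ (Fin n) → ℝ) (N : ℝ≥0),
          (∀ᵐ y, ‖f y‖ₑ ≤ N * ‖y‖ₑ ^ (-α)) →
          ∀ (c : EuclideanSpace ℝ (Fin n)) (r : ℝ), 0 < r → x ∈ closedBall c r →
            maximalCommutator b f x ≤ C * N *
              ((dyadicMaxOsc volume b c r x + K) * (‖x‖ₑ ^ (-α) + ENNReal.ofReal r ^ (-α))) := by
  have hn : 0 < n := by
    have : (0 : ℝ) < n := h0.trans hα
    exact_mod_cast this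
  obtain ⟨C, hC⟩ := exists_lintegral_enorm_sub_mul_enorm_rpow_le
    (volume : Measure (EuclideanSpace ℝ (Fin n))) h0 (by simpa using hα)
  set ω : ℝ≥0∞ := ENNReal.ofReal (2 * √n) ^ n * volume (ball (0 : EuclideanSpace ℝ (Fin n)) 1)
    with hω
  have hωt : ω ≠ ∞ := ENNReal.mul_ne_top (ENNReal.pow_ne_top ENNReal.ofReal_ne_top)
    measure_ball_lt_top.ne
  refine ⟨C * ω.toNNReal, fun b K hb hK hK0 => ?_⟩
  filter_upwards [hC b K hb hK hK0] with x hx f N hf c r hr hxc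
  refine iSup_le fun a => iSup_le fun ℓ => iSup_le fun hℓ => iSup_le fun hxa => ?_
  set X := (dyadicMaxOsc volume b c r x + K) * (‖x‖ₑ ^ (-α) + ENNReal.ofReal r ^ (-α)) with hX
  have hsn : 0 < √(n : ℝ) := Real.sqrt_pos.2 (by exact_mod_cast hn)
  -- The cube lies in a ball about `x` of radius `√n * ℓ`; rounding this up to `2 ^ (k + 1) * r` at
  -- most doubles it, so the volumes remain comparable.
  obtain ⟨k, hk1, hk2⟩ := exists_mem_Ico_zpow (x := √n * ℓ / r) (y := (2 : ℝ)) (by positivity)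
    one_lt_two
  rw [le_div_iff₀ hr] at hk1
  rw [div_lt_iff₀ hr] at hk2
  set ρ : ℝ := 2 ^ (k + 1) * r with hρ
  have hρ2 : ρ ≤ 2 * √n * ℓ := by
    rw [hρ, zpow_add₀ two_ne_zero, zpow_one]
    linarith
  have hsub : cube a ℓ ⊆ closedBall x ρ :=
    (cube_subset_closedBall hℓ.le hxa).trans (closedBall_subset_closedBall hk2.le)
  have hvol : volume (closedBall x ρ) ≤ ω * volume (cube a ℓ) := by
    rw [hω, ← volume_closedBall_eq_mul_volume_cube x a (by positivity) hℓ.le]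
    exact measure_mono (closedBall_subset_closedBall hρ2)
  have hint : ∫⁻ y in cube a ℓ, ‖b x - b y‖ₑ * ‖f y‖ₑ ≤ C * ω * N * X * volume (cube a ℓ) := by
    calc ∫⁻ y in cube a ℓ, ‖b x - b y‖ₑ * ‖f y‖ₑ
        ≤ ∫⁻ y in closedBall x ρ, ‖b x - b y‖ₑ * ‖f y‖ₑ := lintegral_mono_set hsub
      _ ≤ ∫⁻ y in closedBall x ρ, N * (‖b x - b y‖ₑ * ‖y‖ₑ ^ (-α)) := by
          refine lintegral_mono_ae ?_
          filter_upwards [ae_restrict_of_ae hf] with y hy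
          rw [mul_left_comm]
          gcongr
      _ = N * ∫⁻ y in closedBall x ρ, ‖b x - b y‖ₑ * ‖y‖ₑ ^ (-α) :=
          lintegral_const_mul' _ _ ENNReal.coe_ne_top
      _ ≤ N * (C * X * volume (closedBall x ρ)) := by
          gcongr
          exact hx c r hr hxc (k + 1)
      _ ≤ N * (C * X * (ω * volume (cube a ℓ))) := by gcongr
      _ = _ := by ring
  calc _ ≤ (volume (cube a ℓ))⁻¹ * (C * ω * N * X * volume (cube a ℓ)) := by gcongr
    _ = ((volume (cube a ℓ))⁻¹ * volume (cube a ℓ)) * (C * ω * N * X) := by ring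
    _ = _ := by
        rw [ENNReal.inv_mul_cancel (volume_cube_ne_zero a hℓ) (volume_cube_ne_top a ℓ), one_mul]
        push_cast [ENNReal.coe_toNNReal hωt]
        ring

/-- `L^p` average over a cube of the maximal commutator of a function dominated by a power
weight. -/
lemma exists_lintegral_maximalCommutator_rpow_le {α p : ℝ} (h0 : 0 < α) (hp : 1 < p)
    (hα : p * p * α < n) :
    ∃ C : ℝ≥0, ∀ (b : EuclideanSpace ℝ (Fin n) → ℝ) (K : ℝ≥0), LocallyIntegrable b volume →
      BallOscLE volume b K → 0 < K → ∀ (f : EuclideanSpace ℝ (Fin n) → ℝ) (N : ℝ≥0),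
        (∀ᵐ y, ‖f y‖ₑ ≤ N * ‖y‖ₑ ^ (-α)) →
        ∀ (a : EuclideanSpace ℝ (Fin n)) (ℓ : ℝ), 0 < ℓ →
          ∫⁻ x in cube a ℓ, maximalCommutator b f x ^ p ≤
            (C * N * K * ENNReal.ofReal ℓ ^ (-α)) ^ p * volume (cube a ℓ) := by
  have hp0 : 0 < p := by linarith
  have hα' : α < n := by
    refine lt_of_le_of_lt (le_mul_of_one_le_left h0.le ?_) hα
    nlinarith
  have hn : 1 ≤ n := by
    have : (0 : ℝ) < n := h0.trans hα'
    exact_mod_cast this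
  obtain ⟨C₁, hC₁⟩ := exists_maximalCommutator_le h0 hα'
  -- The Hölder exponent `q` is taken equal to `p`, which is the source of the hypothesis on `p * p
  -- * α`.
  obtain ⟨C₂, hC₂⟩ := exists_lintegral_dyadicMaxOsc_mul_weight_rpow_le
    (volume : Measure (EuclideanSpace ℝ (Fin n))) h0 hp.le hp (by simpa using hα)
  set ω : ℝ≥0∞ := ENNReal.ofReal (√n) ^ n * volume (ball (0 : EuclideanSpace ℝ (Fin n)) 1) with hω
  have hωt : ω ≠ ∞ := ENNReal.mul_ne_top (ENNReal.pow_ne_top ENNReal.ofReal_ne_top)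
    measure_ball_lt_top.ne
  refine ⟨C₁ * C₂ * (ω.toNNReal + 1), fun b K hb hK hK0 f N hf a ℓ hℓ => ?_⟩
  have hsn : 1 ≤ √(n : ℝ) := Real.one_le_sqrt.2 (by exact_mod_cast hn)
  set r : ℝ := √n * ℓ with hr
  have hr0 : 0 < r := by positivity
  have hℓr : ENNReal.ofReal r ^ (-α) ≤ ENNReal.ofReal ℓ ^ (-α) :=
    ENNReal.rpow_neg_anti h0.le (ENNReal.ofReal_le_ofReal (le_mul_of_one_le_left hℓ.le hsn))
  have hsub := cube_subset_closedBall hℓ.le (self_mem_cube a hℓ.le)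
  rw [← hr] at hsub
  set X := fun x => (dyadicMaxOsc volume b a r x + K) * (‖x‖ₑ ^ (-α) + ENNReal.ofReal r ^ (-α))
    with hX
  calc ∫⁻ x in cube a ℓ, maximalCommutator b f x ^ p
      ≤ ∫⁻ x in cube a ℓ, (C₁ * N) ^ p * X x ^ p := by
        refine lintegral_mono_ae ?_
        filter_upwards [ae_restrict_of_ae (hC₁ b K hb hK hK0),
          ae_restrict_mem (measurableSet_cube a ℓ)] with x hx hxa
        rw [← ENNReal.mul_rpow_of_nonneg _ _ hp0.le]
        exact ENNReal.rpow_le_rpow (hx f N hf a r hr0 (hsub hxa)) hp0.le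
    _ = (C₁ * N) ^ p * ∫⁻ x in cube a ℓ, X x ^ p :=
        lintegral_const_mul' _ _ (ENNReal.rpow_ne_top_of_nonneg hp0.le
          (ENNReal.mul_ne_top ENNReal.coe_ne_top ENNReal.coe_ne_top))
    _ ≤ (C₁ * N) ^ p * ((C₂ * K * ENNReal.ofReal ℓ ^ (-α)) ^ p *
          ((ω.toNNReal + 1) ^ p * volume (cube a ℓ))) := by
        gcongr
        refine (lintegral_mono_set hsub).trans ((hC₂ b K hb hK hK0 a r hr0).trans ?_)
        gcongr
        rw [hr, volume_closedBall_eq_mul_volume_cube a a (by positivity) hℓ.le, ← hω]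
        gcongr
        nth_rewrite 1 [← ENNReal.coe_toNNReal hωt]
        exact ENNReal.coe_le_add_one_rpow _ hp.le
    _ = _ := by
        rw [← mul_assoc, ← mul_assoc, ← ENNReal.mul_rpow_of_nonneg _ _ hp0.le,
          ← ENNReal.mul_rpow_of_nonneg _ _ hp0.le]
        push_cast
        congr 2
        ring

end Commutator

/-! ### Radially decreasing functions lie below power weights. -/

section RadiallyDecreasing

variable {n : ℕ} {lam : ℝ} {f : EuclideanSpace ℝ (Fin n) → ℝ}

/-- The profile of a radially decreasing function of finite Zygmund–Morrey norm is nonnegative. -/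
lemma nonneg_of_zygmundMorreyNorm_lt_top (hn : n ≠ 0) (hlam : 0 < lam) {φ : ℝ → ℝ}
    (hφ : AntitoneOn φ (Ioi 0)) (hf : ∀ x, x ≠ 0 → f x = φ ‖x‖)
    (hN : zygmundMorreyNorm lam f < ∞) {r : ℝ} (hr : 0 < r) : 0 ≤ φ r := by
  by_contra! hneg
  set N := (zygmundMorreyNorm lam f).toReal with hNdef
  have hδ : 0 < -φ r := by linarith
  -- If `φ r < 0`, then `|f| ≥ -φ r` outside the ball of radius `r`, hence on every cube with lowest
  -- corner `(r, …, r)`; large cubes then make the norm infinite.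
  have key : ∀ ℓ : ℝ, 0 < ℓ → ℓ ^ lam * (-φ r) ≤ N := by
    intro ℓ hℓ
    have h1 : ∀ᵐ y ∂(volume.restrict (cube (WithLp.toLp 2 fun _ : Fin n => r) ℓ)),
        ENNReal.ofReal (-φ r) ≤ ‖f y‖ₑ := by
      filter_upwards [ae_restrict_mem (measurableSet_cube _ _)] with y hy
      have h2 : r ≤ ‖y‖ := by
        have h3 : r ≤ y ⟨0, Nat.pos_of_ne_zero hn⟩ := (hy ⟨0, Nat.pos_of_ne_zero hn⟩).1
        exact h3.trans ((le_abs_self _).trans (PiLp.norm_apply_le y _))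
      have hy0 : y ≠ 0 := norm_pos_iff.1 (hr.trans_le h2)
      rw [hf y hy0, ← ofReal_norm]
      refine ENNReal.ofReal_le_ofReal ?_
      have h4 := hφ (mem_Ioi.2 hr) (mem_Ioi.2 (hr.trans_le h2)) h2
      rw [Real.norm_eq_abs]
      exact (neg_le_neg h4).trans (neg_le_abs _)
    have h5 := mul_ofReal_rpow_le_zygmundMorreyNorm hn lam _ hℓ h1
    rw [ENNReal.ofReal_rpow_of_pos hℓ, ← ENNReal.ofReal_mul (by positivity)] at h5
    exact (ENNReal.ofReal_le_iff_le_toReal hN.ne).1 h5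
  obtain ⟨ℓ, hℓ1, hℓ2⟩ := (((tendsto_rpow_atTop hlam).eventually_gt_atTop (N / (-φ r))).and
    (eventually_gt_atTop 0)).exists
  rw [div_lt_iff₀ hδ] at hℓ1
  exact (key ℓ hℓ2).not_gt hℓ1

variable (n lam) in
/-- A radially decreasing function of the Zygmund–Morrey space is dominated by a power weight. -/
lemma exists_enorm_le_mul_enorm_rpow (hn : n ≠ 0) (hlam : 0 < lam) :
    ∃ C : ℝ≥0, ∀ f : EuclideanSpace ℝ (Fin n) → ℝ, RadiallyDecreasing f →
      zygmundMorreyNorm lam f < ∞ →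
        ∀ᵐ x : EuclideanSpace ℝ (Fin n), ‖f x‖ₑ ≤ C * zygmundMorreyNorm lam f * ‖x‖ₑ ^ (-lam) := by
  have : Nonempty (Fin n) := ⟨⟨0, Nat.pos_of_ne_zero hn⟩⟩
  have hn' : (0 : ℝ) < n := by exact_mod_cast Nat.pos_of_ne_zero hn
  have hsn : 0 < (√(n : ℝ))⁻¹ := by positivity
  set D : ℝ≥0∞ := ENNReal.ofReal (√n)⁻¹ ^ lam with hD
  have hD0 : D ≠ 0 := (ENNReal.rpow_pos (by simpa using hsn) ENNReal.ofReal_ne_top).ne'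
  have hDt : D ≠ ∞ := ENNReal.rpow_ne_top_of_nonneg hlam.le ENNReal.ofReal_ne_top
  refine ⟨D⁻¹.toNNReal, ?_⟩
  rintro f ⟨φ, hφ, hf⟩ hN
  have hae : ∀ᵐ x : EuclideanSpace ℝ (Fin n), x ≠ 0 := by simp [ae_iff]
  filter_upwards [hae] with x hx
  have hx0 : 0 < ‖x‖ := norm_pos_iff.2 hx
  -- With this side, the vertex of `cube 0 ℓ` farthest from the origin is at distance exactly `‖x‖`.
  set ℓ : ℝ := (√n)⁻¹ * ‖x‖ with hℓ
  have hℓ0 : 0 < ℓ := by positivity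
  have hℓx : √n * ℓ = ‖x‖ := by rw [hℓ]; field_simp
  have h1 : ∀ᵐ y ∂(volume.restrict (cube (0 : EuclideanSpace ℝ (Fin n)) ℓ)), ‖f x‖ₑ ≤ ‖f y‖ₑ := by
    filter_upwards [ae_restrict_mem (measurableSet_cube _ _), ae_restrict_of_ae hae] with y hy hy0
    have hyx : ‖y‖ ≤ ‖x‖ := by
      have := cube_subset_closedBall hℓ0.le (self_mem_cube 0 hℓ0.le) hy
      rwa [hℓx, mem_closedBall_zero_iff] at this
    have h2 := hφ (mem_Ioi.2 (norm_pos_iff.2 hy0)) (mem_Ioi.2 hx0) hyx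
    have h3 := nonneg_of_zygmundMorreyNorm_lt_top hn hlam hφ hf hN hx0
    rw [hf x hx, hf y hy0, Real.enorm_eq_ofReal h3, Real.enorm_eq_ofReal (h3.trans h2)]
    exact ENNReal.ofReal_le_ofReal h2
  have h4 := mul_ofReal_rpow_le_zygmundMorreyNorm hn lam 0 hℓ0 h1
  rw [hℓ, ENNReal.ofReal_mul hsn.le, ENNReal.mul_rpow_of_nonneg _ _ hlam.le, ← hD, ofReal_norm] at h4
  have hX0 : ‖x‖ₑ ^ lam ≠ 0 := (ENNReal.rpow_pos (by simpa using hx) enorm_ne_top).ne'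
  have hXt : ‖x‖ₑ ^ lam ≠ ∞ := ENNReal.rpow_ne_top_of_nonneg hlam.le enorm_ne_top
  rw [ENNReal.coe_toNNReal (ENNReal.inv_ne_top.2 hD0), ENNReal.rpow_neg]
  calc ‖f x‖ₑ = D⁻¹ * (D * ‖x‖ₑ ^ lam * ‖f x‖ₑ) * (‖x‖ₑ ^ lam)⁻¹ := by
        rw [show D⁻¹ * (D * ‖x‖ₑ ^ lam * ‖f x‖ₑ) * (‖x‖ₑ ^ lam)⁻¹ =
          (D⁻¹ * D) * (‖x‖ₑ ^ lam * (‖x‖ₑ ^ lam)⁻¹) * ‖f x‖ₑ by ring,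
          ENNReal.inv_mul_cancel hD0 hDt, ENNReal.mul_inv_cancel hX0 hXt, one_mul, one_mul]
    _ ≤ _ := by gcongr

end RadiallyDecreasing

/-! ### The main theorem. -/

theorem mainTheorem10 (n : ℕ) (lam : ℝ) (hlam_pos : 0 < lam) (hlam_lt : lam < n) :
    ∃ c : ℝ≥0, ∀ b : EuclideanSpace ℝ (Fin n) → ℝ, MemBMO b →
      ∀ f : EuclideanSpace ℝ (Fin n) → ℝ, RadiallyDecreasing f → MemZygmundMorrey lam f →
        MemZygmundMorrey lam (maximalCommutator b f) ∧
          zygmundMorreyNorm lam (maximalCommutator b f) ≤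
            c * bmoSeminorm b * zygmundMorreyNorm lam f := by
  have hn : n ≠ 0 := by
    rintro rfl
    norm_num at hlam_lt
    linarith
  -- The exponent is `p = √s`, so that `p > 1` and `p * p * lam = s * lam < n`.
  obtain ⟨s, hs1, hs2⟩ := exists_between ((one_lt_div hlam_pos).2 hlam_lt)
  rw [lt_div_iff₀ hlam_pos] at hs2
  have hp : 1 < √s := Real.lt_sqrt_of_sq_lt (by simpa using hs1)
  obtain ⟨C₁, hC₁⟩ := exists_lintegral_maximalCommutator_rpow_le (n := n) hlam_pos hp
    (by rwa [Real.mul_self_sqrt (by linarith)])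
  obtain ⟨C₂, hC₂⟩ := exists_zygmundAverage_le (n := n) (F := ℝ≥0∞) hp
  obtain ⟨C₃, hC₃⟩ := exists_enorm_le_mul_enorm_rpow n lam hn hlam_pos
  obtain ⟨κ, hκ0, hκ⟩ := exists_ballOscLE_of_bmoSeminorm_le n
  refine ⟨C₂ * C₁ * C₃ * κ, fun b hb f hf hfm => ?_⟩
  have hNt : zygmundMorreyNorm lam f ≠ ∞ := hfm.2.ne
  have hBt : bmoSeminorm b ≠ ∞ := hb.2.ne
  set N := (zygmundMorreyNorm lam f).toNNReal with hNdef
  have hNcoe : (N : ℝ≥0∞) = zygmundMorreyNorm lam f := ENNReal.coe_toNNReal hNt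
  have hfN : ∀ᵐ y : EuclideanSpace ℝ (Fin n), ‖f y‖ₑ ≤ (C₃ * N : ℝ≥0) * ‖y‖ₑ ^ (-lam) := by
    push_cast
    rw [hNcoe]
    exact hC₃ f hf hfm.2
  -- The John–Nirenberg estimate needs a positive oscillation bound, while `‖b‖_*` may vanish; so
  -- `K` is taken strictly above `‖b‖_*` and decreases to it afterwards.
  have hK : ∀ K : ℝ≥0, bmoSeminorm b < K → zygmundMorreyNorm lam (maximalCommutator b f) ≤
      (C₂ * C₁ * C₃ * κ : ℝ≥0) * K * N := by
    intro K hbK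
    have hK0 : 0 < K := by
      have : (0 : ℝ≥0∞) < K := bot_le.trans_lt hbK
      exact_mod_cast this
    refine iSup_le fun a => iSup_le fun ℓ => iSup_le fun hℓ => ?_
    have hint := hC₁ b (κ * K) hb.1 (hκ b K hb.1 hbK.le) (by positivity) f (C₃ * N) hfN a ℓ hℓ
    have havg := hC₂ (maximalCommutator b f) (cube a ℓ) _ (volume_cube_ne_zero a hℓ)
      (volume_cube_ne_top a ℓ) hint
    rw [volume_cube_rpow hn]
    have hL0 : ENNReal.ofReal ℓ ^ lam ≠ 0 :=
      (ENNReal.rpow_pos (by simpa using hℓ) ENNReal.ofReal_ne_top).ne'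
    have hLt : ENNReal.ofReal ℓ ^ lam ≠ ∞ :=
      ENNReal.rpow_ne_top_of_nonneg hlam_pos.le ENNReal.ofReal_ne_top
    calc ENNReal.ofReal ℓ ^ lam * zygmundAverage (maximalCommutator b f) (cube a ℓ)
        ≤ ENNReal.ofReal ℓ ^ lam * (C₂ * (C₁ * (C₃ * N : ℝ≥0) * (κ * K : ℝ≥0) *
            ENNReal.ofReal ℓ ^ (-lam))) := by gcongr
      _ = (ENNReal.ofReal ℓ ^ lam * (ENNReal.ofReal ℓ ^ lam)⁻¹) *
            (C₂ * (C₁ * (C₃ * N : ℝ≥0) * (κ * K : ℝ≥0))) := by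
          rw [ENNReal.rpow_neg]; ring
      _ = _ := by
          rw [ENNReal.mul_inv_cancel hL0 hLt, one_mul]
          push_cast
          ring
  have hmain : zygmundMorreyNorm lam (maximalCommutator b f) ≤
      (C₂ * C₁ * C₃ * κ : ℝ≥0) * bmoSeminorm b * zygmundMorreyNorm lam f := by
    rw [← hNcoe]
    set B := (bmoSeminorm b).toNNReal with hBdef
    have hBcoe : (B : ℝ≥0∞) = bmoSeminorm b := ENNReal.coe_toNNReal hBt
    rw [← hBcoe] at hK ⊢
    have hlim : Tendsto (fun K : ℝ≥0 => C₂ * C₁ * C₃ * κ * K * N) (𝓝[>] B)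
        (𝓝 (C₂ * C₁ * C₃ * κ * B * N)) :=
      (by fun_prop : Continuous fun K : ℝ≥0 => C₂ * C₁ * C₃ * κ * K * N).continuousWithinAt
    have hlim' := ENNReal.tendsto_coe.2 hlim
    push_cast at hlim' hK ⊢
    exact ge_of_tendsto hlim' (eventually_mem_nhdsWithin.mono fun K hBK =>
      hK K (by exact_mod_cast hBK))
  refine ⟨⟨aemeasurable_maximalCommutator hb.1.aestronglyMeasurable.aemeasurable hfm.1, ?_⟩, hmain⟩
  refine hmain.trans_lt ?_
  exact ENNReal.mul_lt_top (ENNReal.mul_lt_top ENNReal.coe_lt_top hb.2) hfm.2
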